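/- Let $G$ be a (Hausdorff) locally compact group with left regular representation $\lambda$ on $L^2(G)$. Let $A(G)$ be the Fourier algebra, i.e. the predual of the group von Neumann algebra $VN(G)$ regarded as an algebra of functions on $G$. Let $MA(G)$ be the algebra of multipliers of $A(G)$ (bounded continuous $v$ with $vA(G)\subseteq A(G)$), with the operator norm of $M_v:u\mapsto vu$ on $A(G)$, and let $M_{cb}A(G)$ be the algebra of those multipliers $v$ for which $M_v$ is completely bounded for the operator space structure of $A(G)=VN(G)_*$, with the completely bounded norm. Let $A_M(G)$ and $A_{cb}(G)$ be the closures of $A(G)$ in $MA(G)$ and in $M_{cb}A(G)$. Let $\mathcal A(G)$ be one of $A(G)$, $A_{cb}(G)$, $A_M(G)$, and let $I$ be a closed ideal of $\mathcal A(G)$ with zero set $Z(I)=\{y\in G: u(y)=0\text{ for all }u\in I\}$. Assume that $Z(I)$ is a set of spectral synthesis for $\mathcal A(G)$: every $u\in\mathcal A(G)$ that vanishes on $Z(I)$ is a norm limit of functions $w\in\mathcal A(G)$ with compact support disjoint from $Z(I)$. Let $x\in G\setminus Z(I)$, and let $\varphi_x\in I^*$ be the functional $u\mapsto u(x)$. The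 dual $I^*$ is an $I$-module under $\langle u\cdot T,v\rangle=\langle T,vu\rangle$. For a closed submodule $X\subseteq I^*$ containing $\varphi_x$, a topologically invariant mean (TIM) on $X$ at $\varphi_x$ is an $m\in X^*$ with $\|m\|=\langle m,\varphi_x\rangle=1$ and $\langle m,u\cdot T\rangle=u(x)\langle m,T\rangle$ for all $u\in I$, $T\in X$. Proposition. Let $Y\subseteq X$ be closed submodules of $I^*$, each containing $\varphi_x$, and let $m$ be a TIM on $Y$ at $\varphi_x$. Then there is a TIM $M$ on $X$ at $\varphi_x$ with $M|_Y=m$. -/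

import Mathlib

open MeasureTheory

noncomputable section

namespace FourierAlg

/-- The dual Banach space `V*` of a normed space `V`, with the topology of the norm of `V`. -/
abbrev NormedDual (V : Type*) [NormedAddCommGroup V] [NormedSpace ℂ V] := StrongDual ℂ V

/-! ### Normed spaces of functions -/

/-- A linear space of complex functions on `G` with a norm for which the point evaluations are
contractions (which makes the seminorm below a norm). -/
structure FunctionSpace (G : Type*) where
  /-- the functions that belong to the space -/
  carrier : Submodule ℂ (G → ℂ)
  /-- the norm of the space -/
  nrm : Seminorm ℂ carrier
  eval_le : ∀ (u : carrier) (x : G), ‖(u : G → ℂ) x‖ ≤ nrm u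

namespace FunctionSpace

variable {G : Type*}

/-- The type of the elements of a function space; it carries the norm `nrm`. -/
def Elem (E : FunctionSpace G) : Type _ := E.carrier

instance : CoeSort (FunctionSpace G) (Type _) := ⟨Elem⟩

instance (E : FunctionSpace G) : AddCommGroup E := inferInstanceAs (AddCommGroup E.carrier)

instance (E : FunctionSpace G) : Module ℂ E := inferInstanceAs (Module ℂ E.carrier)

instance (E : FunctionSpace G) : CoeFun E (fun _ => G → ℂ) := ⟨fun u => u.1⟩

instance (E : FunctionSpace G) : Norm E := ⟨fun u => E.nrm u⟩

theorem normCore (E : FunctionSpace G) : NormedSpace.Core ℂ E where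
  norm_nonneg u := apply_nonneg E.nrm u
  norm_smul c u := map_smul_eq_mul E.nrm c u
  norm_triangle u v := map_add_le_add E.nrm u v
  norm_eq_zero_iff u := by
    constructor
    · intro h
      apply Subtype.ext
      funext x
      have h1 := E.eval_le u x
      have h2 : E.nrm u = 0 := h
      rw [h2] at h1
      exact norm_le_zero_iff.1 h1
    · rintro rfl
      exact map_zero E.nrm

instance (E : FunctionSpace G) : NormedAddCommGroup E := NormedAddCommGroup.ofCore E.normCore

instance (E : FunctionSpace G) : NormedSpace ℂ E := NormedSpace.ofCore E.normCore

/-- The inclusion of a function space into the space of all functions. -/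
def toFun (E : FunctionSpace G) : E →ₗ[ℂ] (G → ℂ) := E.carrier.subtype

theorem norm_apply_le (E : FunctionSpace G) (u : E) (x : G) : ‖u x‖ ≤ ‖u‖ := E.eval_le u x

/-- The functional `φ_x : u ↦ u x`. -/
def eval (E : FunctionSpace G) (x : G) : NormedDual E :=
  LinearMap.mkContinuous ((LinearMap.proj x).comp E.toFun) 1
    (fun u => by rw [one_mul]; exact E.norm_apply_le u x)

/-- A linear subspace of a function space, with the same norm. -/
def restrict (E : FunctionSpace G) (S : Submodule ℂ (G → ℂ)) (hS : S ≤ E.carrier) :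
    FunctionSpace G where
  carrier := S
  nrm := E.nrm.comp (Submodule.inclusion hS)
  eval_le u x := E.eval_le (Submodule.inclusion hS u) x

/-- The closure in `E` of the set of those elements of `E` that lie in `S`, with the norm
of `E`. -/
def closureOf (E : FunctionSpace G) (S : Submodule ℂ (G → ℂ)) : FunctionSpace G :=
  E.restrict (((S.comap E.toFun).topologicalClosure).map E.toFun) (by
    rintro _ ⟨u, -, rfl⟩
    exact u.2)

end FunctionSpace

/-! ### The Fourier algebra -/

section Fourier

variable {G : Type*} [Group G] [TopologicalSpace G] [IsTopologicalGroup G]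
  [MeasurableSpace G] [BorelSpace G]

/-- The left regular representation `(λ(x) f)(y) = f (x⁻¹ y)` on `L²(G)`. -/
def leftRegular (μ : Measure G) [μ.IsMulLeftInvariant] (x : G) :
    Lp ℂ 2 μ →L[ℂ] Lp ℂ 2 μ :=
  (Lp.compMeasurePreservingₗᵢ ℂ (fun y => x⁻¹ * y)
    (measurePreserving_mul_left μ x⁻¹)).toContinuousLinearMap

/-- The functional `T ↦ ∑ₙ ⟨T fₙ, gₙ⟩` on the bounded operators of a Hilbert space (where the
inner product is linear in the first entry, whereas Mathlib's is linear in the second). -/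
def seqFunctional {H : Type*} [NormedAddCommGroup H] [InnerProductSpace ℂ H]
    (f g : ℕ → H) (T : H →L[ℂ] H) : ℂ :=
  ∑' n, inner ℂ (g n) (T (f n))

theorem summable_seqFunctional {H : Type*} [NormedAddCommGroup H] [InnerProductSpace ℂ H]
    {f g : ℕ → H} (h : Summable fun n => ‖f n‖ * ‖g n‖) (T : H →L[ℂ] H) :
    Summable fun n => inner ℂ (g n) (T (f n)) := by
  refine Summable.of_norm_bounded (h.mul_left ‖T‖) (fun n => ?_)
  calc ‖inner ℂ (g n) (T (f n))‖ ≤ ‖g n‖ * ‖T (f n)‖ := norm_inner_le_norm _ _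
    _ ≤ ‖g n‖ * (‖T‖ * ‖f n‖) := by gcongr; exact T.le_opNorm _
    _ = ‖T‖ * (‖f n‖ * ‖g n‖) := by ring

theorem norm_seqFunctional_le {H : Type*} [NormedAddCommGroup H] [InnerProductSpace ℂ H]
    {f g : ℕ → H} (h : Summable fun n => ‖f n‖ * ‖g n‖) (T : H →L[ℂ] H) :
    ‖seqFunctional f g T‖ ≤ ‖T‖ * ∑' n, ‖f n‖ * ‖g n‖ := by
  refine tsum_of_norm_bounded (h.hasSum.mul_left ‖T‖) (fun n => ?_)
  calc ‖inner ℂ (g n) (T (f n))‖ ≤ ‖g n‖ * ‖T (f n)‖ := norm_inner_le_norm _ _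
    _ ≤ ‖g n‖ * (‖T‖ * ‖f n‖) := by gcongr; exact T.le_opNorm _
    _ = ‖T‖ * (‖f n‖ * ‖g n‖) := by ring

/-- Two sequences merged into one. -/
def merge {H : Type*} (f g : ℕ → H) : ℕ → H :=
  fun n => Sum.elim f g (Equiv.natSumNatEquivNat.symm n)

theorem hasSum_merge {H M : Type*} [AddCommMonoid M] [TopologicalSpace M] [ContinuousAdd M]
    (F : H → H → M) {f g f' g' : ℕ → H} {a b : M} (h : HasSum (fun n => F (f n) (g n)) a)
    (h' : HasSum (fun n => F (f' n) (g' n)) b) :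
    HasSum (fun n => F (merge f f' n) (merge g g' n)) (a + b) := by
  have := HasSum.sum (f := fun s : ℕ ⊕ ℕ => F (Sum.elim f f' s) (Sum.elim g g' s)) h h'
  exact (Equiv.natSumNatEquivNat.symm.hasSum_iff (f := fun s : ℕ ⊕ ℕ =>
    F (Sum.elim f f' s) (Sum.elim g g' s))).2 this

/-- `u(x) = ∑ₙ ⟨λ(x) fₙ, gₙ⟩` for all `x`, where `∑ₙ ‖fₙ‖ ‖gₙ‖ < ∞`. -/
structure IsFourierRep (μ : Measure G) [μ.IsMulLeftInvariant] (u : G → ℂ)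
    (f g : ℕ → Lp ℂ 2 μ) : Prop where
  summable : Summable fun n => ‖f n‖ * ‖g n‖
  eq : ∀ x, u x = seqFunctional f g (leftRegular μ x)

theorem seqFunctional_merge {H : Type*} [NormedAddCommGroup H] [InnerProductSpace ℂ H]
    {f g f' g' : ℕ → H} (h : Summable fun n => ‖f n‖ * ‖g n‖)
    (h' : Summable fun n => ‖f' n‖ * ‖g' n‖) (T : H →L[ℂ] H) :
    seqFunctional (merge f f') (merge g g') T = seqFunctional f g T + seqFunctional f' g' T :=
  (hasSum_merge (fun a b => inner ℂ b (T a)) (summable_seqFunctional h T).hasSum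
    (summable_seqFunctional h' T).hasSum).tsum_eq

theorem seqFunctional_smul {H : Type*} [NormedAddCommGroup H] [InnerProductSpace ℂ H]
    (f g : ℕ → H) (c : ℂ) (T : H →L[ℂ] H) :
    seqFunctional (fun n => c • f n) g T = c * seqFunctional f g T := by
  simp only [seqFunctional, map_smul, inner_smul_right, tsum_mul_left]

theorem IsFourierRep.add {μ : Measure G} [μ.IsMulLeftInvariant] {u v : G → ℂ}
    {f g f' g' : ℕ → Lp ℂ 2 μ} (h : IsFourierRep μ u f g) (h' : IsFourierRep μ v f' g') :
    IsFourierRep μ (u + v) (merge f f') (merge g g') where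
  summable := (hasSum_merge (fun a b : Lp ℂ 2 μ => ‖a‖ * ‖b‖) h.summable.hasSum
    h'.summable.hasSum).summable
  eq x := by
    rw [Pi.add_apply, h.eq, h'.eq, seqFunctional_merge h.summable h'.summable]

theorem IsFourierRep.smul {μ : Measure G} [μ.IsMulLeftInvariant] {u : G → ℂ}
    {f g : ℕ → Lp ℂ 2 μ} (h : IsFourierRep μ u f g) (c : ℂ) :
    IsFourierRep μ (c • u) (fun n => c • f n) g where
  summable := by
    simp only [norm_smul, mul_assoc]
    exact h.summable.mul_left _
  eq x := by rw [Pi.smul_apply, h.eq, seqFunctional_smul, smul_eq_mul]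

theorem isFourierRep_zero (μ : Measure G) [μ.IsMulLeftInvariant] :
    IsFourierRep μ 0 (fun _ => 0) (fun _ => 0) where
  summable := by simp
  eq x := by simp [seqFunctional]

/-- The functions of the Fourier algebra `A(G)`: those of the form `x ↦ ω(λ(x))` with `ω` an
ultraweakly continuous functional, `ω(T) = ∑ₙ ⟨T fₙ, gₙ⟩`. -/
def fourierCarrier (μ : Measure G) [μ.IsMulLeftInvariant] : Submodule ℂ (G → ℂ) where
  carrier := {u | ∃ f g, IsFourierRep μ u f g}
  add_mem' := by
    rintro u v ⟨f, g, h⟩ ⟨f', g', h'⟩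
    exact ⟨_, _, h.add h'⟩
  zero_mem' := ⟨_, _, isFourierRep_zero μ⟩
  smul_mem' := by
    rintro c u ⟨f, g, h⟩
    exact ⟨_, _, h.smul c⟩

/-- The norm of `A(G)`, `‖u‖ = inf ∑ₙ ‖fₙ‖ ‖gₙ‖` over all the representations of `u`: the norm of
`A(G)` as the predual of `VN(G)`. -/
def fourierNorm (μ : Measure G) [μ.IsMulLeftInvariant] (u : G → ℂ) : ℝ :=
  sInf {r | ∃ f g, IsFourierRep μ u f g ∧ r = ∑' n, ‖f n‖ * ‖g n‖}

theorem fourierNorm_le {μ : Measure G} [μ.IsMulLeftInvariant] {u : G → ℂ}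
    {f g : ℕ → Lp ℂ 2 μ} (h : IsFourierRep μ u f g) :
    fourierNorm μ u ≤ ∑' n, ‖f n‖ * ‖g n‖ := by
  refine csInf_le ⟨0, ?_⟩ ⟨f, g, h, rfl⟩
  rintro _ ⟨f, g, -, rfl⟩
  exact tsum_nonneg fun n => by positivity

theorem exists_rep_lt {μ : Measure G} [μ.IsMulLeftInvariant] {u : G → ℂ}
    (hu : u ∈ fourierCarrier μ) {r : ℝ} (hr : fourierNorm μ u < r) :
    ∃ f g, IsFourierRep μ u f g ∧ ∑' n, ‖f n‖ * ‖g n‖ < r := by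
  obtain ⟨f, g, h⟩ := hu
  obtain ⟨_, ⟨f', g', h', rfl⟩, hlt⟩ := exists_lt_of_csInf_lt
    (s := {r | ∃ f g, IsFourierRep μ u f g ∧ r = ∑' n, ‖f n‖ * ‖g n‖}) ⟨_, f, g, h, rfl⟩ hr
  exact ⟨f', g', h', hlt⟩

theorem norm_leftRegular_le (μ : Measure G) [μ.IsMulLeftInvariant] (x : G) :
    ‖leftRegular μ x‖ ≤ 1 :=
  LinearIsometry.norm_toContinuousLinearMap_le _

/-- The Fourier algebra `A(G)`. -/
def fourierAlgebra (μ : Measure G) [μ.IsMulLeftInvariant] : FunctionSpace G where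
  carrier := fourierCarrier μ
  nrm := Seminorm.ofSMulLE (fun u => fourierNorm μ u)
    (by
      refine le_antisymm ?_ (Real.sInf_nonneg ?_)
      · simpa using fourierNorm_le (isFourierRep_zero μ)
      · rintro _ ⟨f, g, -, rfl⟩
        exact tsum_nonneg fun n => by positivity)
    (by
      intro u v
      refine le_of_forall_pos_le_add fun ε hε => ?_
      obtain ⟨f, g, h, hlt⟩ := exists_rep_lt u.2 (lt_add_of_pos_right _ (half_pos hε))
      obtain ⟨f', g', h', hlt'⟩ := exists_rep_lt v.2 (lt_add_of_pos_right _ (half_pos hε))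
      have h1 := fourierNorm_le (h.add h')
      have h2 := (hasSum_merge (fun a b : Lp ℂ 2 μ => ‖a‖ * ‖b‖) h.summable.hasSum
        h'.summable.hasSum).tsum_eq
      rw [h2] at h1
      have h3 : (((u + v : fourierCarrier μ)) : G → ℂ) = (u : G → ℂ) + v := rfl
      rw [h3]
      linarith)
    (by
      intro c u
      refine le_of_forall_pos_le_add fun ε hε => ?_
      have hd : 0 < ε / (‖c‖ + 1) := by positivity
      obtain ⟨f, g, h, hlt⟩ := exists_rep_lt u.2 (lt_add_of_pos_right _ hd)
      have h1 := fourierNorm_le (h.smul c)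
      simp only [norm_smul, mul_assoc, tsum_mul_left] at h1
      have h3 : (((c • u : fourierCarrier μ)) : G → ℂ) = c • (u : G → ℂ) := rfl
      rw [h3]
      have h4 : ‖c‖ * (ε / (‖c‖ + 1)) ≤ ε := by
        rw [mul_div_assoc', div_le_iff₀ (by positivity)]
        nlinarith [norm_nonneg c]
      nlinarith [mul_le_mul_of_nonneg_left hlt.le (norm_nonneg c)])
  eval_le u x := by
    refine le_of_forall_pos_le_add fun ε hε => ?_
    obtain ⟨f, g, h, hlt⟩ := exists_rep_lt u.2 (lt_add_of_pos_right _ hε)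
    have h1 := norm_seqFunctional_le h.summable (leftRegular μ x)
    rw [← h.eq] at h1
    have h2 : ‖leftRegular μ x‖ * ∑' n, ‖f n‖ * ‖g n‖ ≤ 1 * ∑' n, ‖f n‖ * ‖g n‖ :=
      mul_le_mul_of_nonneg_right (norm_leftRegular_le μ x)
        (tsum_nonneg fun n => by positivity)
    have h3 : ‖(u : G → ℂ) x‖ ≤ fourierNorm μ u + ε := by linarith
    exact h3

theorem leftRegular_inner (μ : Measure G) [μ.IsMulLeftInvariant] (x : G) (f g : Lp ℂ 2 μ) :
    inner ℂ (leftRegular μ x g) (leftRegular μ x f) = inner ℂ g f :=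
  LinearIsometry.inner_map_map _ _ _

theorem isFourierRep_single (μ : Measure G) [μ.IsMulLeftInvariant] (f g : Lp ℂ 2 μ) :
    IsFourierRep μ (fun y => inner ℂ g (leftRegular μ y f))
      (fun n => if n = 0 then f else 0) (fun n => if n = 0 then g else 0) where
  summable := by
    refine summable_of_ne_finset_zero (s := {0}) fun n hn => ?_
    have : n ≠ 0 := by simpa using hn
    simp [this]
  eq x := by
    rw [seqFunctional, tsum_eq_single 0 (fun n hn => by simp [hn])]
    simp

theorem exists_L2_ne_zero [LocallyCompactSpace G] (μ : Measure G) [μ.IsHaarMeasure] :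
    ∃ f : Lp ℂ 2 μ, f ≠ 0 := by
  obtain ⟨K, hK, hK1⟩ := exists_compact_mem_nhds (1 : G)
  have hfin : μ (interior K) ≠ ⊤ :=
    ne_top_of_le_ne_top hK.measure_lt_top.ne (measure_mono interior_subset)
  have hpos : 0 < μ (interior K) :=
    isOpen_interior.measure_pos μ ⟨1, mem_interior_iff_mem_nhds.2 hK1⟩
  refine ⟨indicatorConstLp 2 isOpen_interior.measurableSet hfin (1 : ℂ), fun h => ?_⟩
  have h1 := congrArg norm h
  rw [norm_indicatorConstLp (by norm_num) (by norm_num), norm_zero, norm_one, one_mul] at h1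
  have h2 : 0 < μ.real (interior K) := ENNReal.toReal_pos hpos.ne' hfin
  exact (Real.rpow_pos_of_pos h2 _).ne' h1

/-! ### The multiplier algebra -/

/-- The multipliers of `A(G)`: the bounded continuous functions `v` with `v A(G) ⊆ A(G)` (the
operator `u ↦ v u` is then automatically bounded). -/
def multiplierCarrier (μ : Measure G) [μ.IsHaarMeasure] : Submodule ℂ (G → ℂ) where
  carrier := {v | Continuous v ∧ (∃ C : ℝ, ∀ x, ‖v x‖ ≤ C) ∧
    ∃ L : fourierAlgebra μ →L[ℂ] fourierAlgebra μ, ∀ u x, L u x = v x * u x}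
  add_mem' := by
    rintro v w ⟨hv, ⟨C, hC⟩, L, hL⟩ ⟨hw, ⟨D, hD⟩, M, hM⟩
    refine ⟨hv.add hw, ⟨C + D, fun x => (norm_add_le _ _).trans (add_le_add (hC x) (hD x))⟩,
      L + M, fun u x => ?_⟩
    have : (L + M) u x = L u x + M u x := rfl
    rw [this, hL, hM, Pi.add_apply, add_mul]
  zero_mem' := ⟨continuous_zero, ⟨0, fun x => by simp⟩, 0, fun u x => by
    have : (0 : fourierAlgebra μ →L[ℂ] fourierAlgebra μ) u x = 0 := rfl
    rw [this, Pi.zero_apply, zero_mul]⟩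
  smul_mem' := by
    rintro c v ⟨hv, ⟨C, hC⟩, L, hL⟩
    refine ⟨hv.const_smul c, ⟨‖c‖ * C, fun x => ?_⟩, c • L, fun u x => ?_⟩
    · rw [Pi.smul_apply, norm_smul]
      exact mul_le_mul_of_nonneg_left (hC x) (norm_nonneg c)
    · have : (c • L) u x = c * L u x := rfl
      rw [this, hL, Pi.smul_apply, smul_eq_mul, mul_assoc]

theorem fourierAlgebra_op_ext {μ : Measure G} [μ.IsHaarMeasure]
    {L M : fourierAlgebra μ →L[ℂ] fourierAlgebra μ} (h : ∀ u x, L u x = M u x) : L = M :=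
  ContinuousLinearMap.ext fun u => Subtype.ext (funext fun x => h u x)

/-- The multiplication operator `M_v : u ↦ v u` on `A(G)`, as a linear function of `v`. -/
def multiplierOp (μ : Measure G) [μ.IsHaarMeasure] :
    multiplierCarrier μ →ₗ[ℂ] (fourierAlgebra μ →L[ℂ] fourierAlgebra μ) where
  toFun v := v.2.2.2.choose
  map_add' v w := fourierAlgebra_op_ext fun u x => by
    have h1 := v.2.2.2.choose_spec u x
    have h2 := w.2.2.2.choose_spec u x
    have h3 := (v + w).2.2.2.choose_spec u x
    have h4 : (v.2.2.2.choose + w.2.2.2.choose) u x =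
      v.2.2.2.choose u x + w.2.2.2.choose u x := rfl
    rw [h3, h4, h1, h2, ← add_mul]
    rfl
  map_smul' c v := fourierAlgebra_op_ext fun u x => by
    have h1 := v.2.2.2.choose_spec u x
    have h3 := (c • v).2.2.2.choose_spec u x
    have h4 : (c • v.2.2.2.choose) u x = c * v.2.2.2.choose u x := rfl
    rw [RingHom.id_apply, h3, h4, h1, ← mul_assoc]
    rfl

theorem multiplierOp_apply {μ : Measure G} [μ.IsHaarMeasure] (v : multiplierCarrier μ)
    (u : fourierAlgebra μ) (x : G) : multiplierOp μ v u x = (v : G → ℂ) x * u x :=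
  v.2.2.2.choose_spec u x

/-- The coefficient function `y ↦ ⟨λ(y) f, g⟩` as an element of `A(G)`. -/
def coeffFun (μ : Measure G) [μ.IsMulLeftInvariant] (f g : Lp ℂ 2 μ) : fourierAlgebra μ :=
  ⟨fun y => inner ℂ g (leftRegular μ y f), _, _, isFourierRep_single μ f g⟩

theorem norm_coeffFun_le (μ : Measure G) [μ.IsMulLeftInvariant] (f g : Lp ℂ 2 μ) :
    ‖coeffFun μ f g‖ ≤ ‖f‖ * ‖g‖ := by
  refine (fourierNorm_le (isFourierRep_single μ f g)).trans_eq ?_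
  rw [tsum_eq_single 0 (fun n hn => by simp [hn])]
  simp

theorem coeffFun_apply_self (μ : Measure G) [μ.IsMulLeftInvariant] (f : Lp ℂ 2 μ) (x : G) :
    coeffFun μ f (leftRegular μ x f) x = (‖f‖ : ℂ) ^ 2 :=
  (leftRegular_inner μ x f f).trans (inner_self_eq_norm_sq_to_K f)

theorem norm_leftRegular_apply (μ : Measure G) [μ.IsMulLeftInvariant] (x : G) (f : Lp ℂ 2 μ) :
    ‖leftRegular μ x f‖ = ‖f‖ :=
  LinearIsometry.norm_map _ _

/-- The multiplier algebra `MA(G)`, with the operator norm of the multiplication operators. -/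
def multiplierAlgebra [LocallyCompactSpace G] (μ : Measure G) [μ.IsHaarMeasure] : FunctionSpace G where
  carrier := multiplierCarrier μ
  nrm := (normSeminorm ℂ (fourierAlgebra μ →L[ℂ] fourierAlgebra μ)).comp (multiplierOp μ)
  eval_le v x := by
    obtain ⟨f, hf⟩ := exists_L2_ne_zero μ
    have hf' : 0 < ‖f‖ ^ 2 := by positivity
    have h1 := (fourierAlgebra μ).norm_apply_le
      (multiplierOp μ v (coeffFun μ f (leftRegular μ x f))) x
    rw [multiplierOp_apply, coeffFun_apply_self, norm_mul, norm_pow, Complex.norm_real,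
      norm_norm] at h1
    have h2 := (multiplierOp μ v).le_opNorm (coeffFun μ f (leftRegular μ x f))
    have h3 := norm_coeffFun_le μ f (leftRegular μ x f)
    rw [norm_leftRegular_apply, ← pow_two] at h3
    have h4 := mul_le_mul_of_nonneg_left h3 (norm_nonneg (multiplierOp μ v))
    exact le_of_mul_le_mul_right (h1.trans (h2.trans h4)) hf'

/-- `A_M(G)`, the closure of `A(G)` in `MA(G)`. -/
def fourierM [LocallyCompactSpace G] (μ : Measure G) [μ.IsHaarMeasure] : FunctionSpace G :=
  (multiplierAlgebra μ).closureOf (fourierCarrier μ)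

/-! ### The group von Neumann algebra and the operator space structure of `A(G)` -/

/-- The ultraweak topology on the bounded operators of a Hilbert space: the coarsest one for which
the functionals `T ↦ ∑ₙ ⟨T fₙ, gₙ⟩` with `∑ₙ ‖fₙ‖ ‖gₙ‖ < ∞` are continuous. -/
def ultraweakTopology (H : Type*) [NormedAddCommGroup H] [InnerProductSpace ℂ H] :
    TopologicalSpace (H →L[ℂ] H) :=
  ⨅ p : {p : (ℕ → H) × (ℕ → H) // Summable fun n => ‖p.1 n‖ * ‖p.2 n‖},
    TopologicalSpace.induced (seqFunctional p.1.1 p.1.2) inferInstance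

/-- The von Neumann algebra `VN(G)` generated by the operators `λ(x)`: the ultraweak closure of
their linear span. -/
def groupVN (μ : Measure G) [μ.IsMulLeftInvariant] : Set (Lp ℂ 2 μ →L[ℂ] Lp ℂ 2 μ) :=
  @closure _ (ultraweakTopology (Lp ℂ 2 μ)) (Submodule.span ℂ (Set.range (leftRegular μ)))

theorem leftRegular_mem_groupVN (μ : Measure G) [μ.IsMulLeftInvariant] (x : G) :
    leftRegular μ x ∈ groupVN μ :=
  @subset_closure _ (ultraweakTopology (Lp ℂ 2 μ)) _ _ (Submodule.subset_span ⟨x, rfl⟩)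

theorem seqFunctional_add {H : Type*} [NormedAddCommGroup H] [InnerProductSpace ℂ H]
    {f g : ℕ → H} (h : Summable fun n => ‖f n‖ * ‖g n‖) (S T : H →L[ℂ] H) :
    seqFunctional f g (S + T) = seqFunctional f g S + seqFunctional f g T := by
  simp only [seqFunctional, add_apply, inner_add_right]
  exact (summable_seqFunctional h S).tsum_add (summable_seqFunctional h T)

theorem seqFunctional_smul_op {H : Type*} [NormedAddCommGroup H] [InnerProductSpace ℂ H]
    (f g : ℕ → H) (c : ℂ) (T : H →L[ℂ] H) :
    seqFunctional f g (c • T) = c * seqFunctional f g T := by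
  simp only [seqFunctional, smul_apply, inner_smul_right, tsum_mul_left]

theorem seqFunctional_eq_of_mem {μ : Measure G} [μ.IsMulLeftInvariant] {u : G → ℂ}
    {f g f' g' : ℕ → Lp ℂ 2 μ} (h : IsFourierRep μ u f g) (h' : IsFourierRep μ u f' g')
    {T : Lp ℂ 2 μ →L[ℂ] Lp ℂ 2 μ} (hT : T ∈ groupVN μ) :
    seqFunctional f g T = seqFunctional f' g' T := by
  have hc : ∀ {f g : ℕ → Lp ℂ 2 μ}, (Summable fun n => ‖f n‖ * ‖g n‖) →
      @Continuous _ _ (ultraweakTopology (Lp ℂ 2 μ)) _ (seqFunctional f g) := by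
    intro f g hs
    exact continuous_iInf_dom (i := ⟨(f, g), hs⟩) continuous_induced_dom
  have hcl : @IsClosed _ (ultraweakTopology (Lp ℂ 2 μ))
      {S | seqFunctional f g S = seqFunctional f' g' S} :=
    @isClosed_eq _ _ _ (ultraweakTopology (Lp ℂ 2 μ)) _ _ _ (hc h.summable)
      (hc h'.summable)
  refine (@closure_minimal _ (ultraweakTopology (Lp ℂ 2 μ)) _ _ ?_ hcl) hT
  intro S hS
  induction hS using Submodule.span_induction with
  | mem S hS =>
    obtain ⟨x, rfl⟩ := hS
    exact (h.eq x).symm.trans (h'.eq x)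
  | zero => simp [seqFunctional]
  | add S S' _ _ hS hS' =>
    change seqFunctional f g S = seqFunctional f' g' S at hS
    change seqFunctional f g S' = seqFunctional f' g' S' at hS'
    change seqFunctional f g (S + S') = seqFunctional f' g' (S + S')
    rw [seqFunctional_add h.summable, seqFunctional_add h'.summable, hS, hS']
  | smul c S _ hS =>
    change seqFunctional f g S = seqFunctional f' g' S at hS
    change seqFunctional f g (c • S) = seqFunctional f' g' (c • S)
    rw [seqFunctional_smul_op, seqFunctional_smul_op, hS]

/-- The duality `⟨T, u⟩` between `VN(G)` and `A(G)`: `⟨T, u⟩ = ∑ₙ ⟨T fₙ, gₙ⟩` for any representation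
`u(x) = ∑ₙ ⟨λ(x) fₙ, gₙ⟩`. -/
def vnPairing (μ : Measure G) [μ.IsMulLeftInvariant] (T : Lp ℂ 2 μ →L[ℂ] Lp ℂ 2 μ)
    (u : fourierAlgebra μ) : ℂ :=
  seqFunctional u.2.choose u.2.choose_spec.choose T

theorem vnPairing_eq {μ : Measure G} [μ.IsMulLeftInvariant] {u : fourierAlgebra μ}
    {f g : ℕ → Lp ℂ 2 μ} (h : IsFourierRep μ u f g)
    {T : Lp ℂ 2 μ →L[ℂ] Lp ℂ 2 μ} (hT : T ∈ groupVN μ) :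
    vnPairing μ T u = seqFunctional f g T :=
  seqFunctional_eq_of_mem u.2.choose_spec.choose_spec h hT

theorem vnPairing_add {μ : Measure G} [μ.IsMulLeftInvariant] (u v : fourierAlgebra μ)
    {T : Lp ℂ 2 μ →L[ℂ] Lp ℂ 2 μ} (hT : T ∈ groupVN μ) :
    vnPairing μ T (u + v) = vnPairing μ T u + vnPairing μ T v := by
  have hu := u.2.choose_spec.choose_spec
  have hv := v.2.choose_spec.choose_spec
  rw [vnPairing_eq (u := u + v) (hu.add hv) hT, seqFunctional_merge hu.summable hv.summable]
  rfl

theorem vnPairing_smul {μ : Measure G} [μ.IsMulLeftInvariant] (c : ℂ) (u : fourierAlgebra μ)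
    {T : Lp ℂ 2 μ →L[ℂ] Lp ℂ 2 μ} (hT : T ∈ groupVN μ) :
    vnPairing μ T (c • u) = c * vnPairing μ T u := by
  have hu := u.2.choose_spec.choose_spec
  rw [vnPairing_eq (u := c • u) (hu.smul c) hT, seqFunctional_smul]
  rfl

theorem vnPairing_leftRegular (μ : Measure G) [μ.IsMulLeftInvariant] (x : G)
    (u : fourierAlgebra μ) : vnPairing μ (leftRegular μ x) u = u x :=
  (u.2.choose_spec.choose_spec.eq x).symm

theorem vnPairing_coeffFun (μ : Measure G) [μ.IsMulLeftInvariant] (f g : Lp ℂ 2 μ)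
    {T : Lp ℂ 2 μ →L[ℂ] Lp ℂ 2 μ} (hT : T ∈ groupVN μ) :
    vnPairing μ T (coeffFun μ f g) = inner ℂ g (T f) := by
  rw [vnPairing_eq (u := coeffFun μ f g) (isFourierRep_single μ f g) hT, seqFunctional,
    tsum_eq_single 0 (fun n hn => by simp [hn])]
  simp

/-- The closed unit ball of `M_k(VN(G))`: the matrices over `VN(G)` that act as a contraction on the
Hilbert space `L²(G) ⊕ ⋯ ⊕ L²(G)`. -/
def vnMatrixBall (μ : Measure G) [μ.IsMulLeftInvariant] (k : ℕ) :
    Set (Matrix (Fin k) (Fin k) (Lp ℂ 2 μ →L[ℂ] Lp ℂ 2 μ)) :=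
  {T | (∀ i j, T i j ∈ groupVN μ) ∧
    ∀ ξ : Fin k → Lp ℂ 2 μ, ∑ i, ‖∑ j, T i j (ξ j)‖ ^ 2 ≤ ∑ j, ‖ξ j‖ ^ 2}

/-- The scalar matrix `(⟨T i j, w r s⟩)` with rows `(i, r)` and columns `(j, s)`. -/
def pairingMatrix (μ : Measure G) [μ.IsMulLeftInvariant] {k n : ℕ}
    (T : Matrix (Fin k) (Fin k) (Lp ℂ 2 μ →L[ℂ] Lp ℂ 2 μ))
    (w : Matrix (Fin n) (Fin n) (fourierAlgebra μ)) :
    Matrix (Fin k × Fin n) (Fin k × Fin n) ℂ :=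
  Matrix.of fun p q => vnPairing μ (T p.1 q.1) (w p.2 q.2)

/-- The norm of `M_n(A(G))` for the operator space structure of `A(G)` as the predual of `VN(G)`:
the completely bounded norm of the map `VN(G) → M_n(ℂ)` that `w` defines. -/
def matrixNorm (μ : Measure G) [μ.IsMulLeftInvariant] {n : ℕ}
    (w : Matrix (Fin n) (Fin n) (fourierAlgebra μ)) : ENNReal :=
  ⨆ (k : ℕ) (T ∈ vnMatrixBall μ k),
    ‖Matrix.toEuclideanCLM (𝕜 := ℂ) (pairingMatrix μ T w)‖ₑ

theorem matrixNorm_add_le (μ : Measure G) [μ.IsMulLeftInvariant] {n : ℕ}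
    (w w' : Matrix (Fin n) (Fin n) (fourierAlgebra μ)) :
    matrixNorm μ (w + w') ≤ matrixNorm μ w + matrixNorm μ w' := by
  refine iSup_le fun k => iSup₂_le fun T hT => ?_
  have h : pairingMatrix μ T (w + w') = pairingMatrix μ T w + pairingMatrix μ T w' := by
    ext p q
    exact vnPairing_add _ _ (hT.1 _ _)
  rw [h, map_add]
  refine (enorm_add_le (Matrix.toEuclideanCLM (𝕜 := ℂ) (pairingMatrix μ T w))
    (Matrix.toEuclideanCLM (𝕜 := ℂ) (pairingMatrix μ T w'))).trans (add_le_add ?_ ?_)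
  · exact le_iSup_of_le k (le_iSup₂_of_le T hT le_rfl)
  · exact le_iSup_of_le k (le_iSup₂_of_le T hT le_rfl)

theorem matrixNorm_smul_le (μ : Measure G) [μ.IsMulLeftInvariant] {n : ℕ} (c : ℂ)
    (w : Matrix (Fin n) (Fin n) (fourierAlgebra μ)) :
    matrixNorm μ (c • w) ≤ ENNReal.ofReal ‖c‖ * matrixNorm μ w := by
  refine iSup_le fun k => iSup₂_le fun T hT => ?_
  have h : pairingMatrix μ T (c • w) = c • pairingMatrix μ T w := by
    ext p q
    exact vnPairing_smul _ _ (hT.1 _ _)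
  rw [h, map_smul, enorm_smul, ← ofReal_norm c]
  gcongr
  exact le_iSup_of_le k (le_iSup₂_of_le T hT le_rfl)

theorem le_matrixNorm_one (μ : Measure G) [μ.IsMulLeftInvariant] (u : fourierAlgebra μ) (x : G) :
    ENNReal.ofReal ‖u x‖ ≤ matrixNorm μ (n := 1) (fun _ _ => u) := by
  have hT : (fun _ _ => leftRegular μ x) ∈ vnMatrixBall μ 1 := by
    refine ⟨fun _ _ => leftRegular_mem_groupVN μ x, fun ξ => ?_⟩
    simp [norm_leftRegular_apply]
  refine le_iSup_of_le 1 (le_iSup₂_of_le _ hT ?_)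
  rw [← ofReal_norm]
  refine ENNReal.ofReal_le_ofReal ?_
  have h := (Matrix.toEuclideanCLM (𝕜 := ℂ)
    (pairingMatrix μ (k := 1) (n := 1) (fun _ _ => leftRegular μ x) (fun _ _ => u))).le_opNorm
    (EuclideanSpace.single (0, 0) 1)
  have h2 := PiLp.norm_apply_le (Matrix.toEuclideanCLM (𝕜 := ℂ)
    (pairingMatrix μ (k := 1) (n := 1) (fun _ _ => leftRegular μ x) (fun _ _ => u))
    (EuclideanSpace.single (0, 0) 1)) (0, 0)
  rw [PiLp.norm_single, norm_one, mul_one] at h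
  refine le_trans (le_of_eq ?_) (h2.trans h)
  congr 1
  rw [EuclideanSpace.single, Matrix.toEuclideanCLM_toLp]
  simp [pairingMatrix, vnPairing_leftRegular]

theorem matrixNorm_coeffFun_le (μ : Measure G) [μ.IsMulLeftInvariant] (f g : Lp ℂ 2 μ) :
    matrixNorm μ (n := 1) (fun _ _ => coeffFun μ f g) ≤ ENNReal.ofReal (‖f‖ * ‖g‖) := by
  refine iSup_le fun k => iSup₂_le fun T hT => ?_
  rw [← ofReal_norm]
  refine ENNReal.ofReal_le_ofReal ?_
  refine ContinuousLinearMap.opNorm_le_bound _ (by positivity) fun a => ?_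
  refine le_of_sq_le_sq ?_ (by positivity)
  rw [mul_pow, EuclideanSpace.norm_sq_eq, EuclideanSpace.norm_sq_eq]
  have h1 := hT.2 (fun j => a (j, 0) • f)
  have h2 : ∀ i : Fin k, (Matrix.toEuclideanCLM (𝕜 := ℂ)
      (pairingMatrix μ T (n := 1) (fun _ _ => coeffFun μ f g)) a) (i, 0) =
      inner ℂ g (∑ j, T i j (a (j, 0) • f)) := by
    intro i
    simp only [inner_sum, map_smul, inner_smul_right]
    change (Matrix.toEuclideanCLM (𝕜 := ℂ)
      (pairingMatrix μ T (n := 1) (fun _ _ => coeffFun μ f g)) (WithLp.toLp 2 a.ofLp)) (i, 0) = _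
    rw [Matrix.toEuclideanCLM_toLp]
    simp only [Matrix.mulVec, dotProduct, Fintype.sum_prod_type, Fin.sum_univ_one, pairingMatrix,
      Matrix.of_apply]
    refine Finset.sum_congr rfl fun j _ => ?_
    rw [vnPairing_coeffFun μ f g (hT.1 _ _), mul_comm]
  simp only [Fintype.sum_prod_type, Fin.sum_univ_one, Fin.isValue]
  calc ∑ i, ‖(Matrix.toEuclideanCLM (𝕜 := ℂ)
      (pairingMatrix μ T (n := 1) (fun _ _ => coeffFun μ f g)) a) (i, 0)‖ ^ 2
      ≤ ∑ i, ‖g‖ ^ 2 * ‖∑ j, T i j (a (j, 0) • f)‖ ^ 2 := by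
        refine Finset.sum_le_sum fun i _ => ?_
        rw [h2, ← mul_pow]
        exact pow_le_pow_left₀ (norm_nonneg _) (norm_inner_le_norm _ _) 2
    _ ≤ ‖g‖ ^ 2 * ∑ j, ‖a (j, 0) • f‖ ^ 2 := by
        rw [← Finset.mul_sum]
        gcongr
    _ = (‖f‖ * ‖g‖) ^ 2 * ∑ j, ‖a (j, 0)‖ ^ 2 := by
        simp only [norm_smul, mul_pow, ← Finset.sum_mul]
        ring

/-! ### Completely bounded multipliers -/

/-- `C` is a bound for the norms of all the amplifications `M_n(A(G)) → M_n(A(G))` of `L`. -/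
def IsCBBound (μ : Measure G) [μ.IsHaarMeasure]
    (L : fourierAlgebra μ →L[ℂ] fourierAlgebra μ) (C : ℝ) : Prop :=
  0 ≤ C ∧ ∀ (n : ℕ) (w : Matrix (Fin n) (Fin n) (fourierAlgebra μ)),
    matrixNorm μ (w.map L) ≤ ENNReal.ofReal C * matrixNorm μ w

theorem IsCBBound.add {μ : Measure G} [μ.IsHaarMeasure]
    {L M : fourierAlgebra μ →L[ℂ] fourierAlgebra μ} {C D : ℝ} (h : IsCBBound μ L C)
    (h' : IsCBBound μ M D) : IsCBBound μ (L + M) (C + D) := by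
  refine ⟨add_nonneg h.1 h'.1, fun n w => ?_⟩
  rw [ENNReal.ofReal_add h.1 h'.1, add_mul]
  exact (matrixNorm_add_le μ (w.map L) (w.map M)).trans (add_le_add (h.2 n w) (h'.2 n w))

theorem IsCBBound.smul {μ : Measure G} [μ.IsHaarMeasure]
    {L : fourierAlgebra μ →L[ℂ] fourierAlgebra μ} {C : ℝ} (h : IsCBBound μ L C) (c : ℂ) :
    IsCBBound μ (c • L) (‖c‖ * C) := by
  refine ⟨mul_nonneg (norm_nonneg c) h.1, fun n w => ?_⟩
  rw [ENNReal.ofReal_mul (norm_nonneg c), mul_assoc]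
  refine (matrixNorm_smul_le μ c (w.map L)).trans ?_
  gcongr
  exact h.2 n w

theorem isCBBound_zero (μ : Measure G) [μ.IsHaarMeasure] : IsCBBound μ 0 0 := by
  refine ⟨le_rfl, fun n w => ?_⟩
  have h := matrixNorm_smul_le μ 0 (w.map (0 : fourierAlgebra μ →L[ℂ] fourierAlgebra μ))
  rw [zero_smul, norm_zero, ENNReal.ofReal_zero, zero_mul] at h
  have h0 : w.map (0 : fourierAlgebra μ →L[ℂ] fourierAlgebra μ) = 0 := rfl
  rw [h0]
  exact h.trans zero_le

/-- The space `CB(A(G))` of the completely bounded linear operators on `A(G)`. -/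
def cbOperators (μ : Measure G) [μ.IsHaarMeasure] :
    Submodule ℂ (fourierAlgebra μ →L[ℂ] fourierAlgebra μ) where
  carrier := {L | ∃ C, IsCBBound μ L C}
  add_mem' := by
    rintro L M ⟨C, h⟩ ⟨D, h'⟩
    exact ⟨_, h.add h'⟩
  zero_mem' := ⟨0, isCBBound_zero μ⟩
  smul_mem' := by
    rintro c L ⟨C, h⟩
    exact ⟨_, h.smul c⟩

/-- The completely bounded norm of an operator on `A(G)`. -/
def cbNormFun (μ : Measure G) [μ.IsHaarMeasure]
    (L : fourierAlgebra μ →L[ℂ] fourierAlgebra μ) : ℝ :=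
  sInf {C | IsCBBound μ L C}

theorem cbNormFun_le {μ : Measure G} [μ.IsHaarMeasure]
    {L : fourierAlgebra μ →L[ℂ] fourierAlgebra μ} {C : ℝ} (h : IsCBBound μ L C) :
    cbNormFun μ L ≤ C :=
  csInf_le ⟨0, fun _ h => h.1⟩ h

theorem exists_cbBound_lt {μ : Measure G} [μ.IsHaarMeasure]
    {L : fourierAlgebra μ →L[ℂ] fourierAlgebra μ} (hL : ∃ C, IsCBBound μ L C) {r : ℝ}
    (hr : cbNormFun μ L < r) : ∃ C, IsCBBound μ L C ∧ C < r :=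
  exists_lt_of_csInf_lt (s := {C | IsCBBound μ L C}) hL hr

theorem cbNormFun_zero (μ : Measure G) [μ.IsHaarMeasure] : cbNormFun μ 0 = 0 :=
  le_antisymm (cbNormFun_le (isCBBound_zero μ)) (Real.sInf_nonneg fun _ h => h.1)

theorem cbNormFun_add_le {μ : Measure G} [μ.IsHaarMeasure]
    {L M : fourierAlgebra μ →L[ℂ] fourierAlgebra μ} (hL : ∃ C, IsCBBound μ L C)
    (hM : ∃ C, IsCBBound μ M C) : cbNormFun μ (L + M) ≤ cbNormFun μ L + cbNormFun μ M := by
  refine le_of_forall_pos_le_add fun ε hε => ?_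
  obtain ⟨C, hC, hlt⟩ := exists_cbBound_lt hL (lt_add_of_pos_right _ (half_pos hε))
  obtain ⟨D, hD, hlt'⟩ := exists_cbBound_lt hM (lt_add_of_pos_right _ (half_pos hε))
  have h := cbNormFun_le (hC.add hD)
  linarith

theorem cbNormFun_smul_le {μ : Measure G} [μ.IsHaarMeasure] (c : ℂ)
    {L : fourierAlgebra μ →L[ℂ] fourierAlgebra μ} (hL : ∃ C, IsCBBound μ L C) :
    cbNormFun μ (c • L) ≤ ‖c‖ * cbNormFun μ L := by
  refine le_of_forall_pos_le_add fun ε hε => ?_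
  have hd : 0 < ε / (‖c‖ + 1) := by positivity
  obtain ⟨C, hC, hlt⟩ := exists_cbBound_lt hL (lt_add_of_pos_right _ hd)
  have h := cbNormFun_le (hC.smul c)
  have h4 : ‖c‖ * (ε / (‖c‖ + 1)) ≤ ε := by
    rw [mul_div_assoc', div_le_iff₀ (by positivity)]
    nlinarith [norm_nonneg c]
  nlinarith [mul_le_mul_of_nonneg_left hlt.le (norm_nonneg c)]

/-- The completely bounded norm, as a seminorm on `CB(A(G))`. -/
def cbNorm (μ : Measure G) [μ.IsHaarMeasure] : Seminorm ℂ (cbOperators μ) :=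
  Seminorm.ofSMulLE (fun L => cbNormFun μ L.1) (cbNormFun_zero μ)
    (fun L M => cbNormFun_add_le L.2 M.2) (fun c L => cbNormFun_smul_le c L.2)

/-- The multipliers `v` of `A(G)` for which `M_v` is completely bounded. -/
def cbMultiplierCarrier (μ : Measure G) [μ.IsHaarMeasure] : Submodule ℂ (G → ℂ) :=
  ((cbOperators μ).comap (multiplierOp μ)).map (multiplierCarrier μ).subtype

theorem cbMultiplierCarrier_le (μ : Measure G) [μ.IsHaarMeasure] :
    cbMultiplierCarrier μ ≤ multiplierCarrier μ := by
  rintro _ ⟨v, -, rfl⟩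
  exact v.2

theorem multiplierOp_mem_cb {μ : Measure G} [μ.IsHaarMeasure] (v : cbMultiplierCarrier μ) :
    multiplierOp μ (Submodule.inclusion (cbMultiplierCarrier_le μ) v) ∈ cbOperators μ := by
  obtain ⟨_, v, hv, rfl⟩ := v
  exact hv

/-- The operator `M_v` as an element of `CB(A(G))`, as a linear function of `v`. -/
def cbMultiplierOp (μ : Measure G) [μ.IsHaarMeasure] :
    cbMultiplierCarrier μ →ₗ[ℂ] cbOperators μ :=
  LinearMap.codRestrict _
    ((multiplierOp μ).comp (Submodule.inclusion (cbMultiplierCarrier_le μ))) multiplierOp_mem_cb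

/-- The algebra `M_cb A(G)` of the completely bounded multipliers of `A(G)`, with the completely
bounded norm. -/
def cbMultiplierAlgebra [LocallyCompactSpace G] (μ : Measure G) [μ.IsHaarMeasure] : FunctionSpace G where
  carrier := cbMultiplierCarrier μ
  nrm := (cbNorm μ).comp (cbMultiplierOp μ)
  eval_le v x := by
    obtain ⟨f, hf⟩ := exists_L2_ne_zero μ
    have hf' : 0 < ‖f‖ ^ 2 := by positivity
    refine le_csInf (cbMultiplierOp μ v).2 fun C hC => ?_
    have h1 := hC.2 1 (fun _ _ => coeffFun μ f (leftRegular μ x f))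
    have h2 := le_matrixNorm_one μ
      ((cbMultiplierOp μ v : fourierAlgebra μ →L[ℂ] fourierAlgebra μ)
        (coeffFun μ f (leftRegular μ x f))) x
    have h3 := matrixNorm_coeffFun_le μ f (leftRegular μ x f)
    have h4 : (cbMultiplierOp μ v : fourierAlgebra μ →L[ℂ] fourierAlgebra μ)
        (coeffFun μ f (leftRegular μ x f)) x = (v : G → ℂ) x * (‖f‖ : ℂ) ^ 2 := by
      rw [← coeffFun_apply_self μ f x]
      exact multiplierOp_apply _ _ _
    rw [h4, norm_mul, norm_pow, Complex.norm_real, norm_norm] at h2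
    rw [norm_leftRegular_apply, ← pow_two] at h3
    have h5 := h2.trans (h1.trans (mul_le_mul_right h3 (ENNReal.ofReal C)))
    rw [← ENNReal.ofReal_mul hC.1, ENNReal.ofReal_le_ofReal_iff (by have := hC.1; positivity)]
      at h5
    exact le_of_mul_le_mul_right h5 hf'

/-- `A_cb(G)`, the closure of `A(G)` in `M_cb A(G)`. -/
def fourierCB [LocallyCompactSpace G] (μ : Measure G) [μ.IsHaarMeasure] : FunctionSpace G :=
  (cbMultiplierAlgebra μ).closureOf (fourierCarrier μ)

end Fourier

/-! ### Ideals, spectral synthesis and topologically invariant means -/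

section Ideals

variable {G : Type*}

/-- A closed ideal of `𝒜` (for pointwise multiplication). -/
structure ClosedIdeal (𝒜 : FunctionSpace G) where
  /-- the functions that belong to the ideal -/
  carrier : Submodule ℂ (G → ℂ)
  le : carrier ≤ 𝒜.carrier
  mul_mem : ∀ v ∈ 𝒜.carrier, ∀ u ∈ carrier, v * u ∈ carrier
  isClosed : IsClosed {u : 𝒜 | (u : G → ℂ) ∈ carrier}

/-- `E` is a set of spectral synthesis for `𝒜`: `E` is closed, and each function of `𝒜` that vanishes
on `E` is a limit of functions of `𝒜` with compact support disjoint from `E`. -/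
def IsSpectralSynthesis [TopologicalSpace G] (𝒜 : FunctionSpace G) (E : Set G) : Prop :=
  IsClosed E ∧ ∀ u : 𝒜, (∀ y ∈ E, u y = 0) → ∀ ε : ℝ, 0 < ε →
    ∃ w : 𝒜, HasCompactSupport w ∧ Disjoint (tsupport w) E ∧ ‖u - w‖ < ε

namespace ClosedIdeal

variable {𝒜 : FunctionSpace G}

/-- A closed ideal as a normed space of functions, with the norm of `𝒜`. -/
def toSpace (I : ClosedIdeal 𝒜) : FunctionSpace G := 𝒜.restrict I.carrier I.le

/-- The zero set `Z(I)`. -/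
def zeroSet (I : ClosedIdeal 𝒜) : Set G := {y | ∀ u ∈ I.carrier, u y = 0}

/-- The product of two elements of `I`. -/
def mul (I : ClosedIdeal 𝒜) (u v : I.toSpace) : I.toSpace :=
  ⟨(u : G → ℂ) * v, I.mul_mem u (I.le u.2) v v.2⟩

/-- The relation `S = u · T` in the dual space `I*`, that is `⟨S, v⟩ = ⟨T, v u⟩` for all `v` in
`I`. -/
def IsAction (I : ClosedIdeal 𝒜) (u : I.toSpace) (T S : NormedDual I.toSpace) : Prop :=
  ∀ v, S v = T (I.mul v u)

/-- `X` is a closed submodule of the `I`-module `I*`. -/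
structure IsClosedSubmodule (I : ClosedIdeal 𝒜) (X : Submodule ℂ (NormedDual I.toSpace)) :
    Prop where
  isClosed : IsClosed (X : Set (NormedDual I.toSpace))
  action_mem : ∀ u, ∀ T ∈ X, ∃ S ∈ X, I.IsAction u T S

/-- `m ∈ X*` is a topologically invariant mean on `X` at `φ_x|_I`. -/
structure IsTIM (I : ClosedIdeal 𝒜) (X : Submodule ℂ (NormedDual I.toSpace)) (x : G)
    (hx : I.toSpace.eval x ∈ X) (m : NormedDual X) : Prop where
  norm_eq : ‖m‖ = 1
  apply_eval : m ⟨I.toSpace.eval x, hx⟩ = 1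
  invariant : ∀ (u : I.toSpace) (T S : X), I.IsAction u T S → m S = u x * m T

end ClosedIdeal

end Ideals

end FourierAlg

end

set_option linter.unusedSectionVars false

open Filter Topology
open scoped CompactlySupported Pointwise

noncomputable section

namespace FourierAlg

namespace FunctionSpace

variable {G : Type*} {E : FunctionSpace G}

/-! Hahn–Banach extends `m` to a functional M₀ of norm one on all of I*, which need not be
invariant. Invariance is restored by a net of functions d in I with d(x) = 1, ‖d‖ → 1 and ‖d u -
u(x) d‖ → 0 for every u in I: take a weak* cluster point M of the functionals T ↦ M₀(d · T). The
norms give ‖M‖ ≤ 1 and the last property of d gives M(u · T) = u(x) M(T). On Y nothing changes,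
because there M₀(d · T) = m(d · T) = d(x) m(T) = m(T). This is `exists_extension`; restricting M to
X gives the theorem.

The net comes from `exists_concentrated`. Since `m` has norm one and m(φ_x) = 1, the norm of φ_x on
I is at least 1, so I contains v with v(x) = 1 and norm close to 1. If e lies in the unit ball of 𝒜
with e(x) = 1, then d = e v lies in I and d u - u(x) d = e z - z(x) e, where z = v u - u(x) v
vanishes at x. It remains to find such e in 𝒜 with e z - z(x) e small for finitely many given z;
this is `HasPointUnits`.

In A(G) one takes e(y) = ⟨λ(y)φ, λ(x)φ⟩ with φ of norm one in L² and supported near the identity.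
Everything rests on a concrete form of Fell's absorption principle: the product of the coefficient
functions of (f, g) and (f', g') is the integral over t of the coefficient functions of (f R_t f', g
R_t g'), where R_t f'(s) = f'(st). Together with Cauchy–Schwarz it shows that A(G) is a Banach
algebra (`exists_fourierAlgebra_mul`). If φ is concentrated near the identity, then φ R_t f is close
to f(t) φ, which makes e u - u(x) e small (`exists_nhds_norm_mul_coeffAt_le`).

For A_M(G) and A_cb(G) the same e serve, because A(G) is dense there and its inclusion is
contractive. For the completely bounded norm, contractivity says that the dual action of w on VN(G)
preserves the matrix unit balls when ‖w‖ < 1 (`vnAction_mem_ball`), which again follows from the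
integral formula. -/

theorem Elem.ext {u v : E} (h : ∀ x, u x = v x) : u = v := Subtype.ext (funext h)

@[simp] theorem add_apply (u v : E) (x : G) : (u + v) x = u x + v x := rfl

@[simp] theorem sub_apply (u v : E) (x : G) : (u - v) x = u x - v x := rfl

@[simp] theorem smul_apply (c : ℂ) (u : E) (x : G) : (c • u) x = c * u x := rfl

@[simp] theorem zero_apply (x : G) : (0 : E) x = 0 := rfl

@[simp] theorem eval_apply (x : G) (u : E) : E.eval x u = u x := rfl

theorem sum_apply {ι : Type*} (s : Finset ι) (u : ι → E) (x : G) :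
    (∑ i ∈ s, u i) x = ∑ i ∈ s, u i x := map_sum (E.eval x) u s

theorem hasSum_apply {ι : Type*} {u : ι → E} {a : E} (h : HasSum u a) (x : G) :
    HasSum (fun i => u i x) (a x) := (E.eval x).hasSum h

end FunctionSpace

/-! ### Completeness of A(G), and coefficient functions as its building blocks -/

section Fourier

variable {G : Type*} [Group G] [TopologicalSpace G] [IsTopologicalGroup G]
  [MeasurableSpace G] [BorelSpace G]

theorem norm_le_of_rep {μ : Measure G} [μ.IsMulLeftInvariant] {u : fourierAlgebra μ}
    {f g : ℕ → Lp ℂ 2 μ} (h : IsFourierRep μ u f g) : ‖u‖ ≤ ∑' n, ‖f n‖ * ‖g n‖ :=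
  fourierNorm_le h

theorem exists_rep_norm_lt {μ : Measure G} [μ.IsMulLeftInvariant] (u : fourierAlgebra μ) {r : ℝ}
    (hr : ‖u‖ < r) : ∃ f g, IsFourierRep μ u f g ∧ ∑' n, ‖f n‖ * ‖g n‖ < r :=
  exists_rep_lt u.2 hr

/-- Representations of the terms that are optimal up to ε/2^(k+1) can be enumerated as a single
sequence, which represents the pointwise sum. The explicit norm bound is what makes the tails of a
series small. -/
theorem exists_hasSum_apply {μ : Measure G} [μ.IsMulLeftInvariant] (u : ℕ → fourierAlgebra μ)
    (hu : Summable fun k => ‖u k‖) {ε : ℝ} (hε : 0 < ε) :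
    ∃ a : fourierAlgebra μ, (∀ x, HasSum (fun k => u k x) (a x)) ∧ ‖a‖ ≤ ∑' k, ‖u k‖ + ε := by
  have h1 : ∀ k, ∃ f g, IsFourierRep μ (u k) f g ∧
      ∑' n, ‖f n‖ * ‖g n‖ < ‖u k‖ + ε / 2 / 2 ^ k := fun k =>
    exists_rep_norm_lt (u k) (lt_add_of_pos_right _ (by positivity))
  choose f g hfg hlt using h1
  have hε' : HasSum (fun k : ℕ => ε / 2 / 2 ^ k) ε := hasSum_geometric_two' ε
  have hs : Summable fun p : ℕ × ℕ => ‖f p.1 p.2‖ * ‖g p.1 p.2‖ := by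
    refine (summable_prod_of_nonneg fun p => by positivity).2 ⟨fun k => (hfg k).summable, ?_⟩
    exact Summable.of_nonneg_of_le (fun k => tsum_nonneg fun n => by positivity)
      (fun k => (hlt k).le) (hu.add hε'.summable)
  obtain ⟨e⟩ : Nonempty (ℕ ≃ ℕ × ℕ) := ⟨Nat.pairEquiv.symm⟩
  have hs' : Summable fun n => ‖f (e n).1 (e n).2‖ * ‖g (e n).1 (e n).2‖ :=
    (e.summable_iff (f := fun p : ℕ × ℕ => ‖f p.1 p.2‖ * ‖g p.1 p.2‖)).2 hs
  have hr : IsFourierRep μ (fun x => ∑' k, u k x) (fun n => f (e n).1 (e n).2)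
      (fun n => g (e n).1 (e n).2) := by
    refine ⟨hs', fun x => ?_⟩
    rw [seqFunctional, e.tsum_eq (fun p : ℕ × ℕ => inner ℂ (g p.1 p.2)
      (leftRegular μ x (f p.1 p.2)))]
    rw [Summable.tsum_prod]
    · exact tsum_congr fun k => (hfg k).eq x
    · exact (e.summable_iff (f := fun p : ℕ × ℕ => inner ℂ (g p.1 p.2)
        (leftRegular μ x (f p.1 p.2)))).1 (summable_seqFunctional hs' (leftRegular μ x))
  refine ⟨⟨_, _, _, hr⟩, fun x => ?_, ?_⟩
  · refine Summable.hasSum (Summable.of_norm_bounded hu fun k => ?_)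
    exact (fourierAlgebra μ).norm_apply_le (u k) x
  · refine (norm_le_of_rep hr).trans ?_
    rw [e.tsum_eq (fun p : ℕ × ℕ => ‖f p.1 p.2‖ * ‖g p.1 p.2‖), hs.tsum_prod, ← hε'.tsum_eq,
      ← hu.tsum_add hε'.summable]
    refine Summable.tsum_le_tsum (fun k => (hlt k).le) hs.prod (hu.add hε'.summable)

/-- An absolutely convergent series has a pointwise sum in A(G). The n-th remainder is the pointwise
sum of the tail, so its norm is at most the tail of the norms plus an error, taken to be 1/(n+1). -/
instance (μ : Measure G) [μ.IsMulLeftInvariant] : CompleteSpace (fourierAlgebra μ) := by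
  refine NormedAddCommGroup.completeSpace_of_summable_imp_tendsto fun u hu => ?_
  obtain ⟨a, ha, -⟩ := exists_hasSum_apply u hu one_pos
  refine ⟨a, tendsto_iff_norm_sub_tendsto_zero.2 ?_⟩
  have hb : ∀ n : ℕ, ‖∑ i ∈ Finset.range n, u i - a‖ ≤
      ∑' k, ‖u (k + n)‖ + 1 / ((n : ℝ) + 1) := fun n => by
    obtain ⟨b, hb, hle⟩ := exists_hasSum_apply (fun k => u (k + n))
      ((summable_nat_add_iff n).2 hu) (ε := 1 / ((n : ℝ) + 1)) (by positivity)
    have : ∑ i ∈ Finset.range n, u i - a = -b := by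
      refine FunctionSpace.Elem.ext fun x => ?_
      have h1 := ((hasSum_nat_add_iff' n).2 (ha x)).unique (hb x)
      rw [FunctionSpace.sub_apply, FunctionSpace.sum_apply, ← neg_sub, h1]
      rfl
    rw [this, norm_neg]
    exact hle
  refine squeeze_zero (fun n => norm_nonneg _) hb ?_
  simpa using (tendsto_sum_nat_add fun k => ‖u k‖).add tendsto_one_div_add_atTop_nhds_zero_nat

/-- The sesquilinear map `(g, f) ↦ ⟨λ(·) f, g⟩` from `L²(G)` to `A(G)`. -/
def coeffL (μ : Measure G) [μ.IsMulLeftInvariant] :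
    Lp ℂ 2 μ →L⋆[ℂ] Lp ℂ 2 μ →L[ℂ] fourierAlgebra μ :=
  LinearMap.mkContinuous₂ (LinearMap.mk₂'ₛₗ (starRingEnd ℂ) (RingHom.id ℂ)
    (fun g f => coeffFun μ f g)
    (fun g g' f => FunctionSpace.Elem.ext fun x => inner_add_left _ _ _)
    (fun c g f => FunctionSpace.Elem.ext fun x => inner_smul_left _ _ _)
    (fun g f f' => FunctionSpace.Elem.ext fun x => by
      change inner ℂ g (leftRegular μ x (f + f')) = _
      rw [map_add, inner_add_right]; rfl)
    (fun c g f => FunctionSpace.Elem.ext fun x => by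
      change inner ℂ g (leftRegular μ x (c • f)) = _
      rw [map_smul, inner_smul_right]; rfl)) 1
    (fun g f => by
      rw [one_mul, mul_comm]
      exact norm_coeffFun_le μ f g)

theorem coeffFun_apply (μ : Measure G) [μ.IsMulLeftInvariant] (f g : Lp ℂ 2 μ) (y : G) :
    coeffFun μ f g y = inner ℂ g (leftRegular μ y f) := rfl

theorem continuous_coeffFun (μ : Measure G) [μ.IsMulLeftInvariant] :
    Continuous fun p : Lp ℂ 2 μ × Lp ℂ 2 μ => coeffFun μ p.1 p.2 :=
  ((coeffL μ).continuous.comp continuous_snd).clm_apply continuous_fst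

theorem coeffFun_sub_left (μ : Measure G) [μ.IsMulLeftInvariant] (f f' g : Lp ℂ 2 μ) :
    coeffFun μ (f - f') g = coeffFun μ f g - coeffFun μ f' g := map_sub (coeffL μ g) f f'

theorem coeffFun_sub_right (μ : Measure G) [μ.IsMulLeftInvariant] (f g g' : Lp ℂ 2 μ) :
    coeffFun μ f (g - g') = coeffFun μ f g - coeffFun μ f g' :=
  DFunLike.congr_fun (map_sub (coeffL μ) g g') f

theorem coeffFun_smul_left (μ : Measure G) [μ.IsMulLeftInvariant] (c : ℂ) (f g : Lp ℂ 2 μ) :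
    coeffFun μ (c • f) g = c • coeffFun μ f g := map_smul (coeffL μ g) c f

theorem coeffFun_smul_right (μ : Measure G) [μ.IsMulLeftInvariant] (c : ℂ) (f g : Lp ℂ 2 μ) :
    coeffFun μ f (c • g) = starRingEnd ℂ c • coeffFun μ f g :=
  DFunLike.congr_fun (map_smulₛₗ (coeffL μ) c g) f

/-- By completeness the series of coefficient functions converges in norm, and point evaluations
identify its sum. Bounded operators may then be applied term by term. -/
theorem IsFourierRep.hasSum {μ : Measure G} [μ.IsMulLeftInvariant] {u : fourierAlgebra μ}
    {f g : ℕ → Lp ℂ 2 μ} (h : IsFourierRep μ u f g) :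
    HasSum (fun n => coeffFun μ (f n) (g n)) u := by
  have hs : Summable fun n => coeffFun μ (f n) (g n) :=
    Summable.of_norm_bounded h.summable fun n => norm_coeffFun_le μ _ _
  convert hs.hasSum
  refine FunctionSpace.Elem.ext fun x => ?_
  rw [← (FunctionSpace.hasSum_apply hs.hasSum x).tsum_eq, h.eq]
  rfl

/-- Every element of `A(G)` is a limit of finite sums of coefficient functions of vectors taken
from a dense set. -/
theorem fourierAlgebra_induction {μ : Measure G} [μ.IsMulLeftInvariant] {ι : Type*}
    {J : ι → Lp ℂ 2 μ} (hJ : DenseRange J) {p : fourierAlgebra μ → Prop}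
    (hcl : IsClosed {u | p u}) (hzero : p 0) (hadd : ∀ u v, p u → p v → p (u + v))
    (hcoeff : ∀ i j, p (coeffFun μ (J i) (J j))) (u : fourierAlgebra μ) : p u := by
  have h1 : ∀ f g, p (coeffFun μ f g) := fun f g =>
    (hJ.prodMap hJ).induction_on (p := fun q : Lp ℂ 2 μ × Lp ℂ 2 μ => p (coeffFun μ q.1 q.2))
      (f, g) (hcl.preimage (continuous_coeffFun μ)) fun q => hcoeff q.1 q.2
  obtain ⟨f, g, h⟩ := u.2
  refine hcl.mem_of_tendsto (IsFourierRep.hasSum (u := u) h) (.of_forall fun s => ?_)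
  change p _
  induction s using Finset.cons_induction with
  | empty => simpa using hzero
  | cons a s ha ih => rw [Finset.sum_cons]; exact hadd _ _ (h1 _ _) ih

end Fourier

end FourierAlg

namespace FourierAlg

/-! ### Compactly supported functions in L², and the integral formula for products of their
coefficient functions -/

section Fourier

variable {G : Type*} [Group G] [TopologicalSpace G] [IsTopologicalGroup G]
  [MeasurableSpace G] [BorelSpace G]

/-- A continuous function with compact support as an element of `L²(G)`. -/
def ccLp (μ : Measure G) [IsFiniteMeasureOnCompacts μ] (f : C_c(G, ℂ)) : Lp ℂ 2 μ :=
  (f.continuous.memLp_of_hasCompactSupport f.hasCompactSupport).toLp f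

theorem coeFn_ccLp (μ : Measure G) [IsFiniteMeasureOnCompacts μ] (f : C_c(G, ℂ)) :
    ccLp μ f =ᵐ[μ] f :=
  MemLp.coeFn_toLp _

theorem ccLp_sub (μ : Measure G) [IsFiniteMeasureOnCompacts μ] (f g : C_c(G, ℂ)) :
    ccLp μ (f - g) = ccLp μ f - ccLp μ g := rfl

theorem ccLp_smul (μ : Measure G) [IsFiniteMeasureOnCompacts μ] (c : ℂ) (f : C_c(G, ℂ)) :
    ccLp μ (c • f) = c • ccLp μ f := rfl

theorem inner_ccLp (μ : Measure G) [IsFiniteMeasureOnCompacts μ] (f g : C_c(G, ℂ)) :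
    inner ℂ (ccLp μ g) (ccLp μ f) = ∫ s, f s * starRingEnd ℂ (g s) ∂μ := by
  rw [L2.inner_def]
  refine integral_congr_ae ?_
  filter_upwards [coeFn_ccLp μ f, coeFn_ccLp μ g] with s hf hg
  rw [hf, hg]
  rfl

theorem norm_ccLp_sq (μ : Measure G) [IsFiniteMeasureOnCompacts μ] (f : C_c(G, ℂ)) :
    ‖ccLp μ f‖ ^ 2 = ∫ s, ‖f s‖ ^ 2 ∂μ := by
  have h := inner_self_eq_norm_sq_to_K (𝕜 := ℂ) (ccLp μ f)
  rw [inner_ccLp] at h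
  simp only [Complex.mul_conj, Complex.normSq_eq_norm_sq] at h
  have h' : ∫ s, ((‖f s‖ ^ 2 : ℝ) : ℂ) ∂μ = ((∫ s, ‖f s‖ ^ 2 ∂μ : ℝ) : ℂ) := integral_ofReal
  refine Complex.ofReal_injective ?_
  rw [← h', h]
  push_cast
  rfl

theorem norm_ccLp_le (μ : Measure G) [IsFiniteMeasureOnCompacts μ] {f g : C_c(G, ℂ)} {C : ℝ}
    (h : ∀ s, ‖f s‖ ≤ C * ‖g s‖) : ‖ccLp μ f‖ ≤ C * ‖ccLp μ g‖ := by
  refine Lp.norm_le_mul_norm_of_ae_le_mul ?_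
  filter_upwards [coeFn_ccLp μ f, coeFn_ccLp μ g] with s hf hg
  rw [hf, hg]
  exact h s

/-- Regularity places s between a compact k and an open u with u \ k of small measure. A Urysohn
function for this pair differs from the indicator only on u \ k, and there by at most 1. -/
theorem exists_hasCompactSupport_sub_indicator_le [LocallyCompactSpace G] (μ : Measure G)
    [μ.Regular] (c : ℂ) {s : Set G} (hs : MeasurableSet s) (hμs : μ s < ⊤) {ε : ENNReal}
    (hε : ε ≠ 0) : ∃ g : G → ℂ, eLpNorm (g - s.indicator fun _ => c) 2 μ ≤ ε ∧
      (Continuous g ∧ HasCompactSupport g) := by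
  obtain ⟨η, hη, hle⟩ := exists_eLpNorm_indicator_le (μ := μ) (p := 2) (by norm_num) c hε
  have hη' : ((η / 2 : NNReal) : ENNReal) ≠ 0 := by simpa using hη.ne'
  obtain ⟨k, hks, hk, hkc, hμk⟩ := hs.exists_isCompact_isClosed_sdiff_lt hμs.ne hη'
  obtain ⟨u, hus, hu, -, hμu⟩ := hs.exists_isOpen_sdiff_lt hμs.ne hη'
  obtain ⟨f, hf1, hf0, hfc, hf⟩ := exists_continuous_one_zero_of_isCompact hk hu.isClosed_compl
    (Set.disjoint_compl_right_iff_subset.2 (hks.trans hus))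
  refine ⟨fun x => (f x : ℂ) * c, ?_, by fun_prop, ?_⟩
  · refine le_trans (eLpNorm_mono (g := (u \ k).indicator fun _ => c) fun x => ?_) (hle _ ?_)
    · by_cases hxk : x ∈ k
      · simp [hxk, hf1 hxk, hks hxk]
      by_cases hxu : x ∈ u
      · have h := hf x
        rw [Pi.sub_apply, Set.indicator_of_mem (show x ∈ u \ k from ⟨hxu, hxk⟩)]
        by_cases hxs : x ∈ s
        · have : (f x : ℂ) * c - c = ((f x - 1 : ℝ) : ℂ) * c := by push_cast; ring
          rw [Set.indicator_of_mem hxs, this, norm_mul, Complex.norm_real]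
          exact mul_le_of_le_one_left (norm_nonneg c) (abs_le.2 ⟨by linarith [h.1], by linarith [h.2]⟩)
        · rw [Set.indicator_of_notMem hxs, sub_zero, norm_mul, Complex.norm_real]
          exact mul_le_of_le_one_left (norm_nonneg c) (abs_le.2 ⟨by linarith [h.1], h.2⟩)
      · have hxs : x ∉ s := fun h => hxu (hus h)
        have h0 : f x = 0 := hf0 hxu
        simp [h0, hxs, hxu]
    · have : u \ k ⊆ (s \ k) ∪ (u \ s) := fun x hx => by
        by_cases hxs : x ∈ s
        · exact Or.inl ⟨hxs, hx.2⟩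
        · exact Or.inr ⟨hx.1, hxs⟩
      refine ((measure_mono this).trans (measure_union_le _ _)).trans ?_
      refine (add_le_add hμk.le hμu.le).trans_eq ?_
      rw [← ENNReal.coe_add, add_halves]
  · have : HasCompactSupport fun x => (f x : ℂ) :=
      hfc.comp_left (g := fun r : ℝ => (r : ℂ)) Complex.ofReal_zero
    exact this.mul_right

theorem denseRange_ccLp [LocallyCompactSpace G] (μ : Measure G) [μ.Regular] :
    DenseRange (ccLp μ) := by
  refine Metric.denseRange_iff.2 fun f ε hε => ?_
  obtain ⟨g, hle, hc, hg⟩ := (Lp.memLp f).induction_dense (by norm_num)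
    (fun g : G → ℂ => Continuous g ∧ HasCompactSupport g)
    (fun c s hs hμs ε hε => exists_hasCompactSupport_sub_indicator_le μ c hs hμs hε)
    (fun f g hf hg => ⟨hf.1.add hg.1, hf.2.add hg.2⟩)
    (fun f hf => (hf.1.memLp_of_hasCompactSupport (p := 2) hf.2).aestronglyMeasurable)
    (ε := ENNReal.ofReal (ε / 2)) (by simpa using hε)
  refine ⟨⟨⟨g, hc⟩, hg⟩, ?_⟩
  rw [dist_eq_norm, Lp.norm_def]
  refine lt_of_le_of_lt (ENNReal.toReal_le_of_le_ofReal (half_pos hε).le ?_) (half_lt_self hε)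
  refine (eLpNorm_congr_ae ?_).trans_le hle
  refine (Lp.coeFn_sub _ _).trans ?_
  filter_upwards [coeFn_ccLp μ (⟨⟨g, hc⟩, hg⟩ : C_c(G, ℂ))] with s hs
  rw [Pi.sub_apply, Pi.sub_apply, hs]
  rfl

/-- The left translate `s ↦ f (x⁻¹ s)`. -/
def ccTranslate (x : G) (f : C_c(G, ℂ)) : C_c(G, ℂ) :=
  ⟨⟨fun s => f (x⁻¹ * s), by fun_prop⟩,
    f.hasCompactSupport.comp_homeomorph (Homeomorph.mulLeft x⁻¹)⟩

@[simp] theorem ccTranslate_apply (x : G) (f : C_c(G, ℂ)) (s : G) :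
    ccTranslate x f s = f (x⁻¹ * s) := rfl

/-- The function `s ↦ f s * f' (s t)`. -/
def ccMulTrans (f f' : C_c(G, ℂ)) (t : G) : C_c(G, ℂ) :=
  ⟨⟨fun s => f s * f' (s * t), by fun_prop⟩, f.hasCompactSupport.mul_right⟩

@[simp] theorem ccMulTrans_apply (f f' : C_c(G, ℂ)) (t s : G) :
    ccMulTrans f f' t s = f s * f' (s * t) := rfl

theorem leftRegular_ccLp (μ : Measure G) [μ.IsMulLeftInvariant] [IsFiniteMeasureOnCompacts μ]
    (x : G) (f : C_c(G, ℂ)) : leftRegular μ x (ccLp μ f) = ccLp μ (ccTranslate x f) := rfl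

theorem coeffFun_ccLp_apply (μ : Measure G) [μ.IsMulLeftInvariant] [IsFiniteMeasureOnCompacts μ]
    (f g : C_c(G, ℂ)) (y : G) : coeffFun μ (ccLp μ f) (ccLp μ g) y =
      ∫ s, f (y⁻¹ * s) * starRingEnd ℂ (g s) ∂μ := by
  rw [coeffFun_apply, leftRegular_ccLp, inner_ccLp]
  rfl

/-- The squared L² distance to F z₀ is an integral depending on the parameter z, with integrand
supported in the fixed compact K; hence it is continuous in z. -/
theorem continuous_ccLp_family (μ : Measure G) [IsFiniteMeasureOnCompacts μ]
    {Z : Type*} [TopologicalSpace Z] {F : Z → C_c(G, ℂ)}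
    (hF : Continuous fun p : Z × G => F p.1 p.2) {K : Set G} (hK : IsCompact K)
    (hs : ∀ z, ∀ s ∉ K, F z s = 0) : Continuous fun z => ccLp μ (F z) := by
  refine continuous_iff_continuousAt.2 fun z₀ => tendsto_iff_norm_sub_tendsto_zero.2 ?_
  have h1 : Continuous fun z => ∫ s, ‖(F z - F z₀) s‖ ^ 2 ∂μ := by
    rw [← continuousOn_univ]
    refine continuousOn_integral_of_compact_support hK ?_ fun z s _ hsK => ?_
    · refine Continuous.continuousOn ?_
      have : Continuous fun p : Z × G => F z₀ p.2 := (F z₀).continuous.comp continuous_snd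
      exact ((hF.sub this).norm.pow 2)
    · rw [CompactlySupportedContinuousMap.sub_apply, hs z s hsK, hs z₀ s hsK]
      simp
  have h2 : (fun z => ‖ccLp μ (F z) - ccLp μ (F z₀)‖) =
      fun z => √(∫ s, ‖(F z - F z₀) s‖ ^ 2 ∂μ) := by
    funext z
    rw [← norm_ccLp_sq, ccLp_sub, Real.sqrt_sq (norm_nonneg _)]
  rw [h2]
  have h3 := (h1.sqrt).tendsto z₀
  simpa using h3

theorem continuous_ccLp_mulTrans (μ : Measure G) [IsFiniteMeasureOnCompacts μ]
    (f f' : C_c(G, ℂ)) : Continuous fun t => ccLp μ (ccMulTrans f f' t) := by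
  refine continuous_ccLp_family μ (F := ccMulTrans f f') (K := tsupport f) ?_
    f.hasCompactSupport fun t s hs => ?_
  · simp only [ccMulTrans_apply]
    fun_prop
  · rw [ccMulTrans_apply, image_eq_zero_of_notMem_tsupport hs, zero_mul]

/-- A compact set outside of which `ccMulTrans f f'` vanishes. -/
def mulTransSupport (f f' : C_c(G, ℂ)) : Set G := (fun p : G × G => p.1⁻¹ * p.2) ''
  (tsupport f ×ˢ tsupport f')

theorem isCompact_mulTransSupport (f f' : C_c(G, ℂ)) : IsCompact (mulTransSupport f f') :=
  (f.hasCompactSupport.isCompact.prod f'.hasCompactSupport).image (by fun_prop)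

theorem mem_mulTransSupport {f f' : C_c(G, ℂ)} {s t : G} (h : f s * f' (s * t) ≠ 0) :
    t ∈ mulTransSupport f f' :=
  ⟨(s, s * t), ⟨subset_tsupport _ (left_ne_zero_of_mul h),
    subset_tsupport _ (right_ne_zero_of_mul h)⟩, by simp⟩

theorem ccMulTrans_eq_zero {f f' : C_c(G, ℂ)} {t : G} (h : t ∉ mulTransSupport f f') :
    ccMulTrans f f' t = 0 :=
  CompactlySupportedContinuousMap.ext fun s => by
    by_contra h'
    exact h (mem_mulTransSupport h')

theorem ccLp_mulTrans_eq_zero (μ : Measure G) [IsFiniteMeasureOnCompacts μ] {f f' : C_c(G, ℂ)}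
    {t : G} (h : t ∉ mulTransSupport f f') : ccLp μ (ccMulTrans f f' t) = 0 := by
  rw [ccMulTrans_eq_zero h]
  rfl

/-- After exchanging the integrals, left invariance in t removes s from |f'(st)|². This is the
isometry of L² ⊗ L² sending f ⊗ f' to (s, t) ↦ f(s) f'(st), the analytic core of Fell's principle.
-/
theorem integral_norm_mulTrans_sq [R1Space G] (μ : Measure G) [μ.IsMulLeftInvariant]
    [IsFiniteMeasureOnCompacts μ] (f f' : C_c(G, ℂ)) :
    ∫ t, ‖ccLp μ (ccMulTrans f f' t)‖ ^ 2 ∂μ = ‖ccLp μ f‖ ^ 2 * ‖ccLp μ f'‖ ^ 2 := by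
  simp only [norm_ccLp_sq, ccMulTrans_apply, norm_mul, mul_pow]
  rw [integral_integral_swap_of_hasCompactSupport]
  · rw [← integral_mul_const]
    refine integral_congr_ae (.of_forall fun s => ?_)
    dsimp only
    rw [integral_const_mul, integral_mul_left_eq_self (fun t => ‖f' t‖ ^ 2)]
  · simp only [Function.uncurry_def]
    fun_prop
  · refine HasCompactSupport.intro
      ((isCompact_mulTransSupport f f').prod f.hasCompactSupport.isCompact) fun p hp => ?_
    by_contra h
    have h' : f p.2 * f' (p.2 * p.1) ≠ 0 := by
      intro h0
      apply h
      simp only [Function.uncurry_def, ← mul_pow, ← norm_mul, h0]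
      simp
    exact hp ⟨mem_mulTransSupport h', subset_tsupport _ (left_ne_zero_of_mul h')⟩

theorem integral_mul_le_sqrt {X : Type*} [MeasurableSpace X] [TopologicalSpace X]
    [OpensMeasurableSpace X] [R1Space X] (μ : Measure X) [IsFiniteMeasureOnCompacts μ] {a b : X → ℝ}
    (ha : Continuous a) (hb : Continuous b) (ha' : HasCompactSupport a)
    (hb' : HasCompactSupport b) (ha0 : ∀ t, 0 ≤ a t) (hb0 : ∀ t, 0 ≤ b t) :
    ∫ t, a t * b t ∂μ ≤ √(∫ t, a t ^ 2 ∂μ) * √(∫ t, b t ^ 2 ∂μ) := by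
  have h := integral_mul_le_Lp_mul_Lq_of_nonneg (μ := μ) Real.HolderConjugate.two_two
    (.of_forall ha0) (.of_forall hb0) (ha.memLp_of_hasCompactSupport ha')
    (hb.memLp_of_hasCompactSupport hb')
  simpa only [Real.rpow_two, ← Real.sqrt_eq_rpow] using h

/-- The product of the coefficient functions of `f, g` and of `f', g'` is
`∫ ⟨λ(·) (f R_t f'), g R_t g'⟩ dt`. -/
theorem mulTrans_integral_apply [R1Space G] (μ : Measure G) [μ.IsMulLeftInvariant]
    [IsFiniteMeasureOnCompacts μ] (f g f' g' : C_c(G, ℂ)) (y : G) :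
    ∫ t, coeffFun μ (ccLp μ (ccMulTrans f f' t)) (ccLp μ (ccMulTrans g g' t)) y ∂μ =
      coeffFun μ (ccLp μ f) (ccLp μ g) y * coeffFun μ (ccLp μ f') (ccLp μ g') y := by
  simp only [coeffFun_ccLp_apply, ccMulTrans_apply]
  rw [integral_integral_swap_of_hasCompactSupport]
  · rw [← integral_mul_const]
    refine integral_congr_ae (.of_forall fun s => ?_)
    dsimp only
    -- Left invariance replaces t by st in the second coefficient function, which puts both sides in
    -- the same form.
    rw [← integral_mul_left_eq_self (fun t => f' (y⁻¹ * t) * starRingEnd ℂ (g' t)) s,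
      ← integral_const_mul]
    refine integral_congr_ae (.of_forall fun t => ?_)
    simp only [map_mul, mul_assoc]
    ring
  · simp only [Function.uncurry_def]
    fun_prop
  · refine HasCompactSupport.intro
      ((isCompact_mulTransSupport g g').prod g.hasCompactSupport.isCompact) fun p hp => ?_
    by_contra h
    have h' : g p.2 * g' (p.2 * p.1) ≠ 0 := by
      intro h0
      apply h
      simp only [Function.uncurry_def, h0]
      simp
    exact hp ⟨mem_mulTransSupport h', subset_tsupport _ (left_ne_zero_of_mul h')⟩

theorem continuous_coeffFun_mulTrans (μ : Measure G) [μ.IsMulLeftInvariant]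
    [IsFiniteMeasureOnCompacts μ] (f g f' g' : C_c(G, ℂ)) :
    Continuous fun t => coeffFun μ (ccLp μ (ccMulTrans f f' t)) (ccLp μ (ccMulTrans g g' t)) :=
  (continuous_coeffFun μ).comp
    ((continuous_ccLp_mulTrans μ f f').prodMk (continuous_ccLp_mulTrans μ g g'))

theorem hasCompactSupport_norm_mulTrans [R1Space G] (μ : Measure G) [IsFiniteMeasureOnCompacts μ]
    (f f' : C_c(G, ℂ)) : HasCompactSupport fun t => ‖ccLp μ (ccMulTrans f f' t)‖ :=
  HasCompactSupport.intro (isCompact_mulTransSupport f f') fun t ht => by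
    rw [ccLp_mulTrans_eq_zero μ ht, norm_zero]

theorem integrable_coeffFun_mulTrans [R1Space G] (μ : Measure G) [μ.IsMulLeftInvariant]
    [IsFiniteMeasureOnCompacts μ] (f g f' g' : C_c(G, ℂ)) : Integrable
    (fun t => coeffFun μ (ccLp μ (ccMulTrans f f' t)) (ccLp μ (ccMulTrans g g' t))) μ := by
  refine (continuous_coeffFun_mulTrans μ f g f' g').integrable_of_hasCompactSupport
    (HasCompactSupport.intro (isCompact_mulTransSupport f f') fun t ht => ?_)
  rw [ccLp_mulTrans_eq_zero μ ht]
  exact map_zero (coeffL μ _)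

theorem integral_fourierAlgebra_apply {μ : Measure G} [μ.IsMulLeftInvariant] {X : Type*}
    [MeasurableSpace X] {ν : Measure X} {F : X → fourierAlgebra μ} (hF : Integrable F ν) (y : G) :
    (∫ t, F t ∂ν) y = ∫ t, F t y ∂ν :=
  (((fourierAlgebra μ).eval y).integral_comp_comm hF).symm

/-- Cauchy–Schwarz in t reduces the bound to the two square integrals computed in
`integral_norm_mulTrans_sq`. -/
theorem norm_integral_mulTrans_le [R1Space G] (μ : Measure G) [μ.IsMulLeftInvariant]
    [IsFiniteMeasureOnCompacts μ] (f g f' g' : C_c(G, ℂ)) :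
    ‖∫ t, coeffFun μ (ccLp μ (ccMulTrans f f' t)) (ccLp μ (ccMulTrans g g' t)) ∂μ‖ ≤
      (‖ccLp μ f‖ * ‖ccLp μ g‖) * (‖ccLp μ f'‖ * ‖ccLp μ g'‖) := by
  have hc := (continuous_ccLp_mulTrans μ f f').norm
  have hc' := (continuous_ccLp_mulTrans μ g g').norm
  calc _ ≤ ∫ t, ‖ccLp μ (ccMulTrans f f' t)‖ * ‖ccLp μ (ccMulTrans g g' t)‖ ∂μ := by
        refine norm_integral_le_of_norm_le ?_ (.of_forall fun t => norm_coeffFun_le μ _ _)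
        exact (hc.mul hc').integrable_of_hasCompactSupport
          (hasCompactSupport_norm_mulTrans μ f f').mul_right
    _ ≤ _ := integral_mul_le_sqrt μ hc hc' (hasCompactSupport_norm_mulTrans μ f f')
        (hasCompactSupport_norm_mulTrans μ g g') (fun _ => norm_nonneg _) fun _ => norm_nonneg _
    _ = _ := by
      rw [integral_norm_mulTrans_sq, integral_norm_mulTrans_sq, ← mul_pow, ← mul_pow,
        Real.sqrt_sq (by positivity), Real.sqrt_sq (by positivity)]
      ring

end Fourier

end FourierAlg

/-! ### A(G) is a Banach algebra of continuous functions -/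

namespace FourierAlg

/-- Elements of E are determined by their values, so p(i) - p(j) is the element attached to J i - J
j and its norm is controlled by that vector. Approximating sequences are therefore mapped to Cauchy
sequences. This extends a bounded additive construction from a dense subgroup without first choosing
a linear map. -/
theorem FunctionSpace.exists_of_dense {G V ι : Type*} {E : FunctionSpace G} [CompleteSpace E]
    [NormedAddCommGroup V] {J : ι → V} (hJ : DenseRange J) (hsub : ∀ i j, ∃ k, J k = J i - J j)
    {q : V → G → ℂ} (hq : ∀ a b y, q (a - b) y = q a y - q b y)
    (hc : ∀ y, Continuous fun a => q a y) {C : ℝ}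
    (h : ∀ i, ∃ p : E, (∀ y, p y = q (J i) y) ∧ ‖p‖ ≤ C * ‖J i‖) (a : V) :
    ∃ p : E, (∀ y, p y = q a y) ∧ ‖p‖ ≤ C * ‖a‖ := by
  obtain ⟨b, hb, hlim⟩ := mem_closure_iff_seq_limit.1 (hJ a)
  choose i hi using hb
  choose p hp hle using h
  have hd : ∀ m n, ‖p (i m) - p (i n)‖ ≤ C * ‖b m - b n‖ := fun m n => by
    obtain ⟨k, hk⟩ := hsub (i m) (i n)
    have : p (i m) - p (i n) = p k := Elem.ext fun y => by
      rw [sub_apply, hp, hp, hp, hk, hq]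
    rw [this, ← hi, ← hi, ← hk]
    exact hle k
  have hcau : CauchySeq fun n => p (i n) := by
    refine cauchySeq_iff_tendsto_dist_atTop_0.2 ?_
    have h1 := (cauchySeq_iff_tendsto_dist_atTop_0.1 hlim.cauchySeq).const_mul C
    rw [mul_zero] at h1
    refine squeeze_zero (fun _ => dist_nonneg) (fun n => ?_) h1
    rw [dist_eq_norm, dist_eq_norm]
    exact hd _ _
  obtain ⟨l, hl⟩ := cauchySeq_tendsto_of_complete hcau
  refine ⟨l, fun y => ?_, ?_⟩
  · refine tendsto_nhds_unique (((E.eval y).continuous.tendsto l).comp hl) ?_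
    refine (((hc y).tendsto a).comp hlim).congr fun n => ?_
    simp [hp, hi]
  · refine le_of_tendsto_of_tendsto hl.norm (hlim.norm.const_mul C) (.of_forall fun n => ?_)
    dsimp only
    rw [← hi]
    exact hle _

section Fourier

variable {G : Type*} [Group G] [TopologicalSpace G] [IsTopologicalGroup G]
  [MeasurableSpace G] [BorelSpace G] [LocallyCompactSpace G]

theorem exists_ccLp_sub (μ : Measure G) [IsFiniteMeasureOnCompacts μ] (f g : C_c(G, ℂ)) :
    ∃ k, ccLp μ k = ccLp μ f - ccLp μ g := ⟨f - g, rfl⟩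

/-- The product of two coefficient functions belongs to `A(G)`. -/
theorem exists_coeffFun_mul (μ : Measure G) [μ.IsHaarMeasure] [μ.Regular] (f g f' g' : Lp ℂ 2 μ) :
    ∃ p : fourierAlgebra μ, (∀ y, p y = coeffFun μ f g y * coeffFun μ f' g' y) ∧
      ‖p‖ ≤ (‖f‖ * ‖g‖) * (‖f'‖ * ‖g'‖) := by
  have hcl : ∀ g y, Continuous fun f => coeffFun μ f g y := fun g y =>
    ((fourierAlgebra μ).eval y).continuous.comp
      ((continuous_coeffFun μ).comp (continuous_id.prodMk continuous_const))
  have hcr : ∀ f y, Continuous fun g => coeffFun μ f g y := fun f y =>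
    ((fourierAlgebra μ).eval y).continuous.comp
      ((continuous_coeffFun μ).comp (continuous_const.prodMk continuous_id))
  have h0 : ∀ f g f' g' : C_c(G, ℂ), ∃ p : fourierAlgebra μ, (∀ y, p y =
      coeffFun μ (ccLp μ f) (ccLp μ g) y * coeffFun μ (ccLp μ f') (ccLp μ g') y) ∧
      ‖p‖ ≤ (‖ccLp μ f‖ * ‖ccLp μ g‖) * (‖ccLp μ f'‖ * ‖ccLp μ g'‖) := fun f g f' g' =>
    ⟨∫ t, coeffFun μ (ccLp μ (ccMulTrans f f' t)) (ccLp μ (ccMulTrans g g' t)) ∂μ, fun y => by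
      rw [integral_fourierAlgebra_apply (integrable_coeffFun_mulTrans μ f g f' g'),
        mulTrans_integral_apply], norm_integral_mulTrans_le μ f g f' g'⟩
  -- The four vectors are freed from compact support one at a time. At each stage the constant in
  -- front of the moving vector is the product of the other three norms.
  have h1 : ∀ (f : Lp ℂ 2 μ) (g f' g' : C_c(G, ℂ)), ∃ p : fourierAlgebra μ, (∀ y, p y =
      coeffFun μ f (ccLp μ g) y * coeffFun μ (ccLp μ f') (ccLp μ g') y) ∧
      ‖p‖ ≤ (‖ccLp μ g‖ * (‖ccLp μ f'‖ * ‖ccLp μ g'‖)) * ‖f‖ := fun f g f' g' => by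
    refine FunctionSpace.exists_of_dense (denseRange_ccLp μ) (exists_ccLp_sub μ)
      (q := fun f y => coeffFun μ f (ccLp μ g) y * coeffFun μ (ccLp μ f') (ccLp μ g') y)
      (fun a b y => ?_) (fun y => (hcl _ y).mul continuous_const) (fun f => ?_) f
    · rw [coeffFun_sub_left, FunctionSpace.sub_apply, sub_mul]
    · obtain ⟨p, hp, hle⟩ := h0 f g f' g'
      exact ⟨p, hp, hle.trans_eq (by ring)⟩
  have h2 : ∀ (f g : Lp ℂ 2 μ) (f' g' : C_c(G, ℂ)), ∃ p : fourierAlgebra μ, (∀ y, p y =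
      coeffFun μ f g y * coeffFun μ (ccLp μ f') (ccLp μ g') y) ∧
      ‖p‖ ≤ (‖f‖ * (‖ccLp μ f'‖ * ‖ccLp μ g'‖)) * ‖g‖ := fun f g f' g' => by
    refine FunctionSpace.exists_of_dense (denseRange_ccLp μ) (exists_ccLp_sub μ)
      (q := fun g y => coeffFun μ f g y * coeffFun μ (ccLp μ f') (ccLp μ g') y)
      (fun a b y => ?_) (fun y => (hcr _ y).mul continuous_const) (fun g => ?_) g
    · rw [coeffFun_sub_right, FunctionSpace.sub_apply, sub_mul]
    · obtain ⟨p, hp, hle⟩ := h1 f g f' g'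
      exact ⟨p, hp, hle.trans_eq (by ring)⟩
  have h3 : ∀ (f g f' : Lp ℂ 2 μ) (g' : C_c(G, ℂ)), ∃ p : fourierAlgebra μ, (∀ y, p y =
      coeffFun μ f g y * coeffFun μ f' (ccLp μ g') y) ∧
      ‖p‖ ≤ (‖f‖ * ‖g‖ * ‖ccLp μ g'‖) * ‖f'‖ := fun f g f' g' => by
    refine FunctionSpace.exists_of_dense (denseRange_ccLp μ) (exists_ccLp_sub μ)
      (q := fun f' y => coeffFun μ f g y * coeffFun μ f' (ccLp μ g') y)
      (fun a b y => ?_) (fun y => continuous_const.mul (hcl _ y)) (fun f' => ?_) f'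
    · rw [coeffFun_sub_left, FunctionSpace.sub_apply, mul_sub]
    · obtain ⟨p, hp, hle⟩ := h2 f g f' g'
      exact ⟨p, hp, hle.trans_eq (by ring)⟩
  have h4 : ∃ p : fourierAlgebra μ, (∀ y, p y = coeffFun μ f g y * coeffFun μ f' g' y) ∧
      ‖p‖ ≤ (‖f‖ * ‖g‖ * ‖f'‖) * ‖g'‖ := by
    refine FunctionSpace.exists_of_dense (denseRange_ccLp μ) (exists_ccLp_sub μ)
      (q := fun g' y => coeffFun μ f g y * coeffFun μ f' g' y)
      (fun a b y => ?_) (fun y => continuous_const.mul (hcr _ y)) (fun g' => ?_) g'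
    · rw [coeffFun_sub_right, FunctionSpace.sub_apply, mul_sub]
    · obtain ⟨p, hp, hle⟩ := h3 f g f' g'
      exact ⟨p, hp, hle.trans_eq (by ring)⟩
  obtain ⟨p, hp, hle⟩ := h4
  exact ⟨p, hp, hle.trans_eq (by ring)⟩

theorem exists_fourierAlgebra_mul {μ : Measure G} [μ.IsHaarMeasure] [μ.Regular]
    (u v : fourierAlgebra μ) :
    ∃ p : fourierAlgebra μ, (∀ y, p y = u y * v y) ∧ ‖p‖ ≤ ‖u‖ * ‖v‖ := by
  have key : ∀ r s, ‖u‖ < r → ‖v‖ < s →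
      ∃ p : fourierAlgebra μ, (∀ y, p y = u y * v y) ∧ ‖p‖ ≤ r * s := by
    intro r s hr hs
    obtain ⟨f, g, hu, hur⟩ := exists_rep_norm_lt u hr
    obtain ⟨f', g', hv, hvs⟩ := exists_rep_norm_lt v hs
    choose p hp hle using fun k : ℕ × ℕ => exists_coeffFun_mul μ (f k.1) (g k.1) (f' k.2) (g' k.2)
    have hsum : Summable fun k : ℕ × ℕ => (‖f k.1‖ * ‖g k.1‖) * (‖f' k.2‖ * ‖g' k.2‖) :=
      hu.summable.mul_of_nonneg hv.summable (fun n => by positivity) (fun n => by positivity)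
    have hps : Summable p := Summable.of_norm_bounded hsum hle
    refine ⟨∑' k, p k, fun y => ?_, ?_⟩
    · refine (FunctionSpace.hasSum_apply hps.hasSum y).unique ?_
      have h1 := FunctionSpace.hasSum_apply (IsFourierRep.hasSum hu) y
      have h2 := FunctionSpace.hasSum_apply (IsFourierRep.hasSum hv) y
      have h3 : Summable fun k : ℕ × ℕ =>
          coeffFun μ (f k.1) (g k.1) y * coeffFun μ (f' k.2) (g' k.2) y :=
        (FunctionSpace.hasSum_apply hps.hasSum y).summable.congr fun k => hp k y
      exact (h1.mul h2 h3).congr_fun fun k => hp k y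
    · refine (tsum_of_norm_bounded hsum.hasSum hle).trans ?_
      rw [← hu.summable.tsum_mul_tsum hv.summable hsum]
      gcongr
      exact (norm_nonneg u).trans hr.le
  obtain ⟨p, hp, -⟩ := key _ _ (lt_add_one ‖u‖) (lt_add_one ‖v‖)
  refine ⟨p, hp, ?_⟩
  -- The product is determined by its values, so the same p satisfies the bounds for all ε.
  have hlim : Tendsto (fun ε : ℝ => (‖u‖ + ε) * (‖v‖ + ε)) (𝓝[>] 0) (𝓝 (‖u‖ * ‖v‖)) := by
    have : Continuous fun ε : ℝ => (‖u‖ + ε) * (‖v‖ + ε) := by fun_prop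
    simpa using (this.tendsto 0).mono_left nhdsWithin_le_nhds
  refine ge_of_tendsto hlim (eventually_mem_nhdsWithin.mono fun ε hε => ?_)
  obtain ⟨p', hp', hle⟩ := key _ _ (lt_add_of_pos_right ‖u‖ hε) (lt_add_of_pos_right ‖v‖ hε)
  rwa [show p = p' from FunctionSpace.Elem.ext fun y => (hp y).trans (hp' y).symm]

/-- The pointwise product of two elements of `A(G)`. -/
def fourierMulFun {μ : Measure G} [μ.IsHaarMeasure] [μ.Regular] (u v : fourierAlgebra μ) :
    fourierAlgebra μ :=
  (exists_fourierAlgebra_mul u v).choose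

theorem fourierMulFun_apply {μ : Measure G} [μ.IsHaarMeasure] [μ.Regular]
    (u v : fourierAlgebra μ) (y : G) : fourierMulFun u v y = u y * v y :=
  (exists_fourierAlgebra_mul u v).choose_spec.1 y

/-- The product of `A(G)`. -/
def fourierMul (μ : Measure G) [μ.IsHaarMeasure] [μ.Regular] :
    fourierAlgebra μ →L[ℂ] fourierAlgebra μ →L[ℂ] fourierAlgebra μ :=
  LinearMap.mkContinuous₂ (LinearMap.mk₂ ℂ fourierMulFun
    (fun u u' v => FunctionSpace.Elem.ext fun y => by
      simp only [FunctionSpace.add_apply, fourierMulFun_apply, add_mul])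
    (fun c u v => FunctionSpace.Elem.ext fun y => by
      simp only [FunctionSpace.smul_apply, fourierMulFun_apply,
        mul_assoc])
    (fun u v v' => FunctionSpace.Elem.ext fun y => by
      simp only [FunctionSpace.add_apply, fourierMulFun_apply, mul_add])
    (fun c u v => FunctionSpace.Elem.ext fun y => by
      simp only [FunctionSpace.smul_apply, fourierMulFun_apply]
      ring)) 1
    (fun u v => by
      rw [one_mul]
      exact (exists_fourierAlgebra_mul u v).choose_spec.2)

@[simp] theorem fourierMul_apply {μ : Measure G} [μ.IsHaarMeasure] [μ.Regular]
    (u v : fourierAlgebra μ) (y : G) : fourierMul μ u v y = u y * v y :=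
  (exists_fourierAlgebra_mul u v).choose_spec.1 y

theorem norm_fourierMul_le {μ : Measure G} [μ.IsHaarMeasure] [μ.Regular]
    (u v : fourierAlgebra μ) : ‖fourierMul μ u v‖ ≤ ‖u‖ * ‖v‖ :=
  (exists_fourierAlgebra_mul u v).choose_spec.2

theorem fourierMul_ccLp (μ : Measure G) [μ.IsHaarMeasure] [μ.Regular] (f g f' g' : C_c(G, ℂ)) :
    fourierMul μ (coeffFun μ (ccLp μ f) (ccLp μ g)) (coeffFun μ (ccLp μ f') (ccLp μ g')) =
      ∫ t, coeffFun μ (ccLp μ (ccMulTrans f f' t)) (ccLp μ (ccMulTrans g g' t)) ∂μ :=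
  FunctionSpace.Elem.ext fun y => by
    rw [integral_fourierAlgebra_apply (integrable_coeffFun_mulTrans μ f g f' g'),
      mulTrans_integral_apply, fourierMul_apply]

/-- The norm of A(G) dominates the uniform norm, so continuity survives limits; for compactly
supported vectors the coefficient function is a parametric integral over a fixed compact set. -/
theorem fourierAlgebra_continuous {μ : Measure G} [μ.IsHaarMeasure] [μ.Regular]
    (u : fourierAlgebra μ) : Continuous u := by
  refine fourierAlgebra_induction (p := fun u => Continuous u) (denseRange_ccLp μ) ?_ ?_ ?_ ?_ u
  · refine isClosed_of_closure_subset fun u hu => ?_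
    obtain ⟨v, hv, hlim⟩ := mem_closure_iff_seq_limit.1 hu
    refine TendstoUniformly.continuous (F := fun n => (v n : G → ℂ)) (p := atTop) ?_
      (.of_forall hv)
    refine Metric.tendstoUniformly_iff.2 fun ε hε => ?_
    filter_upwards [Metric.tendsto_nhds.1 hlim ε hε] with n hn y
    rw [dist_comm] at hn
    refine lt_of_le_of_lt ?_ hn
    rw [dist_eq_norm, dist_eq_norm]
    exact (fourierAlgebra μ).norm_apply_le (u - v n) y
  · exact continuous_const
  · exact fun u v hu hv => hu.add hv
  · intro f g
    have : (coeffFun μ (ccLp μ f) (ccLp μ g) : G → ℂ) =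
        fun y => ∫ s, f (y⁻¹ * s) * starRingEnd ℂ (g s) ∂μ :=
      funext fun y => coeffFun_ccLp_apply μ f g y
    rw [this, ← continuousOn_univ]
    refine continuousOn_integral_of_compact_support g.hasCompactSupport ?_ fun y s _ hs => ?_
    · simp only [Function.uncurry_def]
      fun_prop
    · rw [image_eq_zero_of_notMem_tsupport hs, map_zero, mul_zero]

end Fourier

end FourierAlg

namespace FourierAlg

/-! ### Norm-one functions in A(G) concentrated at a point -/

section Fourier

variable {G : Type*} [Group G] [TopologicalSpace G] [IsTopologicalGroup G]
  [MeasurableSpace G] [BorelSpace G] [LocallyCompactSpace G]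

theorem exists_nhds_one_translate_close (f : C_c(G, ℂ)) (x : G) {K : Set G} (hK : IsCompact K)
    {δ : ℝ} (hδ : 0 < δ) : ∃ V ∈ 𝓝 (1 : G), ∀ v ∈ V, ∀ t ∈ K, ‖f (x * v * t) - f (x * t)‖ ≤ δ := by
  have hf : Continuous (Function.uncurry fun v t : G => f (x * v * t)) := by
    simp only [Function.uncurry_def]
    fun_prop
  obtain ⟨V, hV, h⟩ := hK.mem_uniformity_of_prod (s := Set.univ) (q := (1 : G))
    hf.continuousOn (Set.mem_univ _) (Metric.dist_mem_uniformity hδ)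
  rw [nhdsWithin_univ] at hV
  refine ⟨V, hV, fun v hv t ht => ?_⟩
  have h1 : dist (f (x * v * t)) (f (x * 1 * t)) < δ := h v hv t ht
  rw [mul_one, dist_eq_norm] at h1
  exact h1.le

/-- The coefficient function `y ↦ ⟨λ(y) φ, λ(x) φ⟩`. -/
def coeffAt (μ : Measure G) [μ.IsHaarMeasure] (x : G) (φ : C_c(G, ℂ)) : fourierAlgebra μ :=
  coeffFun μ (ccLp μ φ) (leftRegular μ x (ccLp μ φ))

theorem norm_coeffAt_le (μ : Measure G) [μ.IsHaarMeasure] (x : G) (φ : C_c(G, ℂ)) :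
    ‖coeffAt μ x φ‖ ≤ ‖ccLp μ φ‖ * ‖ccLp μ φ‖ := by
  have h := norm_coeffFun_le μ (ccLp μ φ) (leftRegular μ x (ccLp μ φ))
  rwa [norm_leftRegular_apply] at h

/-- On the support of φ the factor f(st) is nearly f(t), and on that of its translate by x the
factor g(st) is nearly g(xt). Both vectors of the integrand are then nearly scalar multiples of the
vectors of `coeffAt μ x φ`. -/
theorem norm_mulTrans_integrand_le (μ : Measure G) [μ.IsHaarMeasure] (x t : G)
    {φ f g : C_c(G, ℂ)} (hφ : ‖ccLp μ φ‖ = 1) {δ Cf Cg : ℝ}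
    (hδf : ∀ s, φ s ≠ 0 → ‖f (s * t) - f t‖ ≤ δ)
    (hδg : ∀ s, φ s ≠ 0 → ‖g (x * s * t) - g (x * t)‖ ≤ δ)
    (hCf : ∀ s, ‖f s‖ ≤ Cf) (hCg : ∀ s, ‖g s‖ ≤ Cg) :
    ‖coeffFun μ (ccLp μ (ccMulTrans φ f t)) (ccLp μ (ccMulTrans (ccTranslate x φ) g t)) -
      (f t * starRingEnd ℂ (g (x * t))) • coeffAt μ x φ‖ ≤ δ * Cg + Cf * δ := by
  have hψ : ‖ccLp μ (ccTranslate x φ)‖ = 1 := by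
    rw [← leftRegular_ccLp, norm_leftRegular_apply, hφ]
  obtain ⟨s₀, hs₀⟩ : ∃ s, φ s ≠ 0 := by
    by_contra! h
    have : φ = 0 := CompactlySupportedContinuousMap.ext h
    rw [this] at hφ
    exact zero_ne_one ((norm_zero (E := Lp ℂ 2 μ)).symm.trans hφ)
  have hδ0 : 0 ≤ δ := (norm_nonneg _).trans (hδf s₀ hs₀)
  have hCf0 : 0 ≤ Cf := (norm_nonneg _).trans (hCf 1)
  -- The two vectors are replaced one after the other.
  have hsplit : coeffFun μ (ccLp μ (ccMulTrans φ f t))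
      (ccLp μ (ccMulTrans (ccTranslate x φ) g t)) -
      (f t * starRingEnd ℂ (g (x * t))) • coeffAt μ x φ =
      coeffFun μ (ccLp μ (ccMulTrans φ f t - f t • φ))
        (ccLp μ (ccMulTrans (ccTranslate x φ) g t)) +
      coeffFun μ (ccLp μ (f t • φ)) (ccLp μ (ccMulTrans (ccTranslate x φ) g t -
        g (x * t) • ccTranslate x φ)) := by
    rw [ccLp_sub, ccLp_sub, coeffFun_sub_left, coeffFun_sub_right, ccLp_smul, ccLp_smul,
      coeffFun_smul_right, coeffFun_smul_left μ (f t) _ (ccLp μ (ccTranslate x φ)),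
      smul_smul, mul_comm (starRingEnd ℂ _), ← leftRegular_ccLp]
    simp only [coeffAt]
    abel
  have h1 : ‖ccLp μ (ccMulTrans φ f t - f t • φ)‖ ≤ δ * 1 := by
    rw [← hφ]
    refine norm_ccLp_le μ fun s => ?_
    have : (ccMulTrans φ f t - f t • φ) s = (f (s * t) - f t) * φ s := by
      simp only [CompactlySupportedContinuousMap.sub_apply, ccMulTrans_apply,
        CompactlySupportedContinuousMap.smul_apply, smul_eq_mul]
      ring
    rw [this, norm_mul]
    by_cases h0 : φ s = 0
    · simp [h0]
    · gcongr
      exact hδf s h0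
  have h2 : ‖ccLp μ (ccMulTrans (ccTranslate x φ) g t)‖ ≤ Cg * 1 := by
    rw [← hψ]
    refine norm_ccLp_le μ fun s => ?_
    rw [ccMulTrans_apply, norm_mul, mul_comm]
    gcongr
    exact hCg _
  have h3 : ‖ccLp μ (f t • φ)‖ ≤ Cf := by
    rw [ccLp_smul, norm_smul, hφ, mul_one]
    exact hCf t
  have h4 : ‖ccLp μ (ccMulTrans (ccTranslate x φ) g t - g (x * t) • ccTranslate x φ)‖ ≤ δ * 1 := by
    rw [← hψ]
    refine norm_ccLp_le μ fun s => ?_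
    have : (ccMulTrans (ccTranslate x φ) g t - g (x * t) • ccTranslate x φ) s =
        (g (x * (x⁻¹ * s) * t) - g (x * t)) * φ (x⁻¹ * s) := by
      simp only [CompactlySupportedContinuousMap.sub_apply, ccMulTrans_apply,
        CompactlySupportedContinuousMap.smul_apply, smul_eq_mul, ccTranslate_apply,
        mul_inv_cancel_left]
      ring
    rw [this, norm_mul, ccTranslate_apply]
    by_cases h0 : φ (x⁻¹ * s) = 0
    · simp [h0]
    · gcongr
      exact hδg _ h0
  rw [mul_one] at h1 h2 h4
  rw [hsplit]
  refine (norm_add_le _ _).trans (add_le_add ?_ ?_)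
  · exact (norm_coeffFun_le μ _ _).trans (mul_le_mul h1 h2 (norm_nonneg _) hδ0)
  · exact (norm_coeffFun_le μ _ _).trans (mul_le_mul h3 h4 (norm_nonneg _) hCf0)

theorem exists_bound_cc (f : C_c(G, ℂ)) : ∃ C, ∀ s, ‖f s‖ ≤ C :=
  f.continuous.bounded_above_of_compact_support f.hasCompactSupport

/-- The functions u with this property are stable under limits, since `coeffAt` has norm at most 1,
and under sums. For a coefficient function of compactly supported f, g, the product is an integral
over t whose integrand is nearly f(t) conj(g(xt)) times `coeffAt μ x φ`, and the integral of this
scalar is u(x). -/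
theorem exists_nhds_norm_mul_coeffAt_le (μ : Measure G) [μ.IsHaarMeasure] [μ.Regular] (x : G)
    (u : fourierAlgebra μ) : ∀ ε : ℝ, 0 < ε → ∃ V ∈ 𝓝 (1 : G), ∀ φ : C_c(G, ℂ),
      (∀ s ∉ V, φ s = 0) → ‖ccLp μ φ‖ = 1 →
        ‖fourierMul μ (coeffAt μ x φ) u - u x • coeffAt μ x φ‖ ≤ ε := by
  refine fourierAlgebra_induction (p := fun u => ∀ ε : ℝ, 0 < ε → ∃ V ∈ 𝓝 (1 : G),
    ∀ φ : C_c(G, ℂ), (∀ s ∉ V, φ s = 0) → ‖ccLp μ φ‖ = 1 →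
      ‖fourierMul μ (coeffAt μ x φ) u - u x • coeffAt μ x φ‖ ≤ ε) (denseRange_ccLp μ) ?_ ?_ ?_ ?_ u
  · refine isClosed_of_closure_subset fun u hu ε hε => ?_
    obtain ⟨v, hv, hd⟩ := Metric.mem_closure_iff.1 hu (ε / 3) (by positivity)
    obtain ⟨V, hV, h⟩ := hv (ε / 3) (by positivity)
    refine ⟨V, hV, fun φ hφV hφ => ?_⟩
    have he : ‖coeffAt μ x φ‖ ≤ 1 := by simpa [hφ] using norm_coeffAt_le μ x φ
    rw [dist_eq_norm] at hd
    have h1 : ‖fourierMul μ (coeffAt μ x φ) (u - v)‖ ≤ ε / 3 :=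
      (norm_fourierMul_le _ _).trans
        ((mul_le_of_le_one_left (norm_nonneg _) he).trans hd.le)
    have h2 : ‖(u - v) x • coeffAt μ x φ‖ ≤ ε / 3 := by
      rw [norm_smul]
      exact (mul_le_of_le_one_right (norm_nonneg _) he).trans
        (((fourierAlgebra μ).norm_apply_le _ _).trans hd.le)
    have h3 : fourierMul μ (coeffAt μ x φ) u - u x • coeffAt μ x φ =
        fourierMul μ (coeffAt μ x φ) (u - v) - (u - v) x • coeffAt μ x φ +
        (fourierMul μ (coeffAt μ x φ) v - v x • coeffAt μ x φ) := by
      rw [map_sub, FunctionSpace.sub_apply, sub_smul]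
      abel
    rw [h3]
    have h4 := norm_add_le (fourierMul μ (coeffAt μ x φ) (u - v) - (u - v) x • coeffAt μ x φ)
      (fourierMul μ (coeffAt μ x φ) v - v x • coeffAt μ x φ)
    have h5 := norm_sub_le (fourierMul μ (coeffAt μ x φ) (u - v)) ((u - v) x • coeffAt μ x φ)
    have h6 := h φ hφV hφ
    linarith
  · refine fun ε hε => ⟨Set.univ, univ_mem, fun φ _ _ => ?_⟩
    rw [map_zero, FunctionSpace.zero_apply, zero_smul, sub_zero, norm_zero]
    exact hε.le
  · intro u v hu hv ε hε
    obtain ⟨V, hV, h⟩ := hu (ε / 2) (half_pos hε)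
    obtain ⟨W, hW, h'⟩ := hv (ε / 2) (half_pos hε)
    refine ⟨V ∩ W, inter_mem hV hW, fun φ hφV hφ => ?_⟩
    have h1 := h φ (fun s hs => hφV s fun h => hs h.1) hφ
    have h2 := h' φ (fun s hs => hφV s fun h => hs h.2) hφ
    rw [map_add, FunctionSpace.add_apply, add_smul, add_sub_add_comm]
    exact (norm_add_le _ _).trans (by linarith)
  · intro f g ε hε
    obtain ⟨N, hN, hN1⟩ := exists_compact_mem_nhds (1 : G)
    obtain ⟨Cf, hCf⟩ := exists_bound_cc f
    obtain ⟨Cg, hCg⟩ := exists_bound_cc g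
    have hCf0 : 0 ≤ Cf := (norm_nonneg _).trans (hCf 1)
    have hCg0 : 0 ≤ Cg := (norm_nonneg _).trans (hCg 1)
    -- With φ supported in N, both parts of the integrand vanish for t outside K, so the uniform
    -- estimate is integrated over a set of finite measure.
    let K : Set G := N⁻¹ * tsupport f
    have hK : IsCompact K := hN.inv.mul f.hasCompactSupport
    have hKf : ∀ s ∈ N, ∀ t ∉ K, f (s * t) = 0 := fun s hs t ht => by
      refine image_eq_zero_of_notMem_tsupport fun h => ht ?_
      exact ⟨s⁻¹, Set.inv_mem_inv.2 hs, s * t, h, inv_mul_cancel_left s t⟩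
    have hB : 0 < (Cg + Cf) * μ.real K + 1 := by positivity
    -- The integrated error is δ (Cg + Cf) μ(K) ≤ ε; the added 1 keeps the denominator positive.
    let δ := ε / ((Cg + Cf) * μ.real K + 1)
    have hδ : 0 < δ := by positivity
    obtain ⟨V, hV, h⟩ := exists_nhds_one_translate_close f 1 hK hδ
    obtain ⟨W, hW, h'⟩ := exists_nhds_one_translate_close g x hK hδ
    refine ⟨N ∩ (V ∩ W), inter_mem hN1 (inter_mem hV hW), fun φ hφV hφ => ?_⟩
    have hmem : ∀ s, φ s ≠ 0 → s ∈ N ∧ s ∈ V ∧ s ∈ W := fun s hs => by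
      by_contra h
      exact hs (hφV s h)
    have hux : coeffFun μ (ccLp μ f) (ccLp μ g) x = ∫ t, f t * starRingEnd ℂ (g (x * t)) ∂μ := by
      rw [coeffFun_ccLp_apply,
        ← integral_mul_left_eq_self (fun s => f (x⁻¹ * s) * starRingEnd ℂ (g s)) x]
      simp
    have hint : Integrable (fun t => f t * starRingEnd ℂ (g (x * t))) μ := by
      refine Continuous.integrable_of_hasCompactSupport (by fun_prop) ?_
      exact f.hasCompactSupport.mul_right
    rw [hux, ← integral_smul_const, coeffAt, leftRegular_ccLp, fourierMul_ccLp,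
      ← integral_sub (integrable_coeffFun_mulTrans μ _ _ _ _) (hint.smul_const _)]
    have hzero : ∀ t ∉ K, coeffFun μ (ccLp μ (ccMulTrans φ f t))
        (ccLp μ (ccMulTrans (ccTranslate x φ) g t)) - (f t * starRingEnd ℂ (g (x * t))) •
        coeffFun μ (ccLp μ φ) (ccLp μ (ccTranslate x φ)) = 0 := fun t ht => by
      have h1 : ccMulTrans φ f t = 0 := CompactlySupportedContinuousMap.ext fun s => by
        by_cases h0 : φ s = 0
        · simp [h0]
        · simp [hKf s (hmem s h0).1 t ht]
      have h2 : f t = 0 := by simpa using hKf 1 (mem_of_mem_nhds hN1) t ht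
      rw [h1, h2, zero_mul, zero_smul, sub_zero]
      exact map_zero (coeffL μ _)
    rw [← setIntegral_eq_integral_of_forall_compl_eq_zero hzero]
    refine (norm_setIntegral_le_of_norm_le_const (C := δ * Cg + Cf * δ) hK.measure_lt_top
      fun t ht => ?_).trans ?_
    · refine norm_mulTrans_integrand_le μ x t hφ (fun s hs => ?_) (fun s hs => ?_) hCf hCg
      · simpa using h s (hmem s hs).2.1 t ht
      · exact h' s (hmem s hs).2.2 t ht
    · have : (δ * Cg + Cf * δ) * μ.real K = δ * ((Cg + Cf) * μ.real K) := by ring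
      rw [this]
      have h7 : δ * ((Cg + Cf) * μ.real K + 1) = ε := div_mul_cancel₀ ε hB.ne'
      linarith

theorem exists_cc_norm_eq_one (μ : Measure G) [μ.IsHaarMeasure] {V : Set G} (hV : V ∈ 𝓝 (1 : G)) :
    ∃ φ : C_c(G, ℂ), (∀ s ∉ V, φ s = 0) ∧ ‖ccLp μ φ‖ = 1 := by
  obtain ⟨f, hf1, hf0, hfc, hf⟩ := exists_continuous_one_zero_of_isCompact
    (isCompact_singleton (x := (1 : G))) (isOpen_interior (s := V)).isClosed_compl
    (Set.disjoint_compl_right_iff_subset.2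
      (Set.singleton_subset_iff.2 (mem_interior_iff_mem_nhds.2 hV)))
  let φ : C_c(G, ℂ) := ⟨⟨fun s => (f s : ℂ), by fun_prop⟩,
    hfc.comp_left (g := fun r : ℝ => (r : ℂ)) Complex.ofReal_zero⟩
  have hφ : ∀ s, φ s = (f s : ℂ) := fun s => rfl
  have hpos : 0 < ‖ccLp μ φ‖ := by
    have h : 0 < ‖ccLp μ φ‖ ^ 2 := by
      rw [norm_ccLp_sq]
      refine Continuous.integral_pos_of_hasCompactSupport_nonneg_nonzero (x := 1)
        (by fun_prop) ?_ (fun s => by positivity) ?_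
      · exact φ.hasCompactSupport.comp_left (g := fun z : ℂ => ‖z‖ ^ 2) (by simp)
      · have : f 1 = 1 := hf1 rfl
        simp [hφ, this]
    exact (norm_nonneg _).lt_of_ne' fun h0 => by simp [h0] at h
  refine ⟨((‖ccLp μ φ‖⁻¹ : ℝ) : ℂ) • φ, fun s hs => ?_, ?_⟩
  · have : f s = 0 := hf0 fun h => hs (interior_subset h)
    simp [hφ, this]
  · rw [ccLp_smul, norm_smul, Complex.norm_real, norm_inv, norm_norm, inv_mul_cancel₀ hpos.ne']

/-- The functions of norm one with `e(x) = 1` that are concentrated at `x`. -/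
theorem exists_coeffAt (μ : Measure G) [μ.IsHaarMeasure] [μ.Regular] (x : G)
    (F : Finset (fourierAlgebra μ)) {ε : ℝ} (hε : 0 < ε) :
    ∃ e : fourierAlgebra μ, ‖e‖ ≤ 1 ∧ e x = 1 ∧
      ∀ u ∈ F, ‖fourierMul μ e u - u x • e‖ ≤ ε := by
  choose V hV h using fun u => exists_nhds_norm_mul_coeffAt_le μ x u ε hε
  obtain ⟨φ, hφV, hφ⟩ := exists_cc_norm_eq_one μ ((biInter_finset_mem F).2 fun u _ => hV u)
  refine ⟨coeffAt μ x φ, by simpa [hφ] using norm_coeffAt_le μ x φ, ?_, fun u hu => ?_⟩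
  · rw [coeffAt, coeffFun_apply_self, hφ]
    simp
  · exact h u φ (fun s hs => hφV s fun h => hs (Set.mem_iInter₂.1 h u hu)) hφ

end Fourier

end FourierAlg

namespace FourierAlg

/-! ### Ultraweak closures of subspaces -/

section Ultraweak

variable {H : Type*} [NormedAddCommGroup H] [InnerProductSpace ℂ H]

/-- The ultraweakly continuous functionals. -/
def ultraweakFunctionals (H : Type*) [NormedAddCommGroup H] [InnerProductSpace ℂ H] :
    Submodule ℂ ((H →L[ℂ] H) → ℂ) where
  carrier := {φ | ∃ f g : ℕ → H, (Summable fun n => ‖f n‖ * ‖g n‖) ∧ φ = seqFunctional f g}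
  add_mem' := by
    rintro _ _ ⟨f, g, h, rfl⟩ ⟨f', g', h', rfl⟩
    refine ⟨merge f f', merge g g', (hasSum_merge (fun a b : H => ‖a‖ * ‖b‖) h.hasSum
      h'.hasSum).summable, funext fun T => ?_⟩
    rw [Pi.add_apply, seqFunctional_merge h h']
  zero_mem' := ⟨fun _ => 0, fun _ => 0, by simp, funext fun T => by simp [seqFunctional]⟩
  smul_mem' := by
    rintro c _ ⟨f, g, h, rfl⟩
    refine ⟨fun n => c • f n, g, ?_, funext fun T => ?_⟩
    · simp only [norm_smul, mul_assoc]
      exact h.mul_left _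
    · rw [Pi.smul_apply, seqFunctional_smul, smul_eq_mul]

/-- The linear map `T ↦ ∑ₙ ⟨T fₙ, gₙ⟩`. -/
def seqFunctionalₗ {f g : ℕ → H} (h : Summable fun n => ‖f n‖ * ‖g n‖) : (H →L[ℂ] H) →ₗ[ℂ] ℂ where
  toFun := seqFunctional f g
  map_add' := seqFunctional_add h
  map_smul' := seqFunctional_smul_op f g

/-- A basic neighbourhood of S involves finitely many functionals, which together form a linear map
Φ into a finite-dimensional space. If Φ(S) were outside Φ(W), a linear form would separate them.
Composed with Φ, it is a combination of the functionals, hence again of the form `seqFunctional f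
g`, contradicting the assumption. -/
theorem mem_ultraweak_closure {W : Submodule ℂ (H →L[ℂ] H)} {S : H →L[ℂ] H}
    (hS : ∀ f g : ℕ → H, (Summable fun n => ‖f n‖ * ‖g n‖) →
      (∀ R ∈ W, seqFunctional f g R = 0) → seqFunctional f g S = 0) :
    S ∈ @closure _ (ultraweakTopology H) (W : Set (H →L[ℂ] H)) := by
  classical
  let P := {p : (ℕ → H) × (ℕ → H) // Summable fun n => ‖p.1 n‖ * ‖p.2 n‖}
  have hfin : ∀ s : Finset P, ∃ R ∈ W, ∀ p ∈ s,
      seqFunctional p.1.1 p.1.2 R = seqFunctional p.1.1 p.1.2 S := by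
    intro s
    let Φ : (H →L[ℂ] H) →ₗ[ℂ] (s → ℂ) := LinearMap.pi fun p => seqFunctionalₗ p.1.2
    by_contra hcon
    have hnot : Φ S ∉ W.map Φ := by
      rintro ⟨R, hR, h⟩
      exact hcon ⟨R, hR, fun p hp => congrFun h ⟨p, hp⟩⟩
    obtain ⟨c, hc, hker⟩ := Submodule.exists_le_ker_of_notMem hnot
    have hmem : (fun R => c (Φ R)) ∈ ultraweakFunctionals H := by
      have : (fun R => c (Φ R)) = ∑ p : s, c (Pi.single p 1) •
          seqFunctional (H := H) p.1.1.1 p.1.1.2 := by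
        funext R
        rw [LinearMap.pi_apply_eq_sum_univ c, Finset.sum_apply]
        refine Finset.sum_congr rfl fun p _ => ?_
        rw [Pi.smul_apply, smul_eq_mul, smul_eq_mul, mul_comm]
        congr 2
        funext q
        simp [Pi.single_apply, eq_comm]
      rw [this]
      exact Submodule.sum_mem _ fun p _ => Submodule.smul_mem _ _ ⟨_, _, p.1.2, rfl⟩
    obtain ⟨f, g, hfg, h⟩ := hmem
    refine hc ?_
    rw [show c (Φ S) = seqFunctional f g S from congrFun h S]
    refine hS f g hfg fun R hR => ?_
    rw [← congrFun h R]
    exact hker ⟨R, hR, rfl⟩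
  refine (@mem_closure_iff_nhds _ (ultraweakTopology H) _ _).2 fun t ht => ?_
  rw [ultraweakTopology, nhds_iInf, mem_iInf] at ht
  obtain ⟨s, hs, V, hV, rfl⟩ := ht
  obtain ⟨R, hR, h⟩ := hfin hs.toFinset
  refine ⟨R, Set.mem_iInter.2 fun p => ?_, hR⟩
  have h1 := hV p
  rw [nhds_induced] at h1
  obtain ⟨U, hU, hUV⟩ := h1
  refine hUV ?_
  rw [Set.mem_preimage, h p.1 (hs.mem_toFinset.2 p.2)]
  exact mem_of_mem_nhds hU

end Ultraweak

/-! ### The action of A(G) on VN(G), and complete boundedness of multiplication by elements of A(G)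
-/

section Fourier

variable {G : Type*} [Group G] [TopologicalSpace G] [IsTopologicalGroup G]
  [MeasurableSpace G] [BorelSpace G]

theorem norm_vnPairing_le {μ : Measure G} [μ.IsMulLeftInvariant]
    {T : Lp ℂ 2 μ →L[ℂ] Lp ℂ 2 μ} (hT : T ∈ groupVN μ) (u : fourierAlgebra μ) :
    ‖vnPairing μ T u‖ ≤ ‖T‖ * ‖u‖ := by
  have key : ∀ r, ‖u‖ < r → ‖vnPairing μ T u‖ ≤ ‖T‖ * r := fun r hr => by
    obtain ⟨f, g, h, hlt⟩ := exists_rep_norm_lt u hr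
    rw [vnPairing_eq h hT]
    exact (norm_seqFunctional_le h.summable T).trans
      (mul_le_mul_of_nonneg_left hlt.le (norm_nonneg T))
  have hlim : Tendsto (fun r : ℝ => ‖T‖ * r) (𝓝[>] ‖u‖) (𝓝 (‖T‖ * ‖u‖)) :=
    ((continuous_const.mul continuous_id).tendsto ‖u‖).mono_left nhdsWithin_le_nhds
  exact ge_of_tendsto hlim (eventually_mem_nhdsWithin.mono key)

/-- The functional `u ↦ ⟨T, u⟩` on `A(G)`. -/
def vnPairingL {μ : Measure G} [μ.IsMulLeftInvariant] {T : Lp ℂ 2 μ →L[ℂ] Lp ℂ 2 μ}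
    (hT : T ∈ groupVN μ) : fourierAlgebra μ →L[ℂ] ℂ :=
  LinearMap.mkContinuous
    { toFun := vnPairing μ T
      map_add' := fun u v => vnPairing_add u v hT
      map_smul' := fun c u => vnPairing_smul c u hT } ‖T‖ (norm_vnPairing_le hT)

variable [LocallyCompactSpace G]

theorem fourierMul_comm {μ : Measure G} [μ.IsHaarMeasure] [μ.Regular] (u v : fourierAlgebra μ) :
    fourierMul μ u v = fourierMul μ v u :=
  FunctionSpace.Elem.ext fun y => by rw [fourierMul_apply, fourierMul_apply, mul_comm]

/-- The module action of `A(G)` on `VN(G)`, the operator `S` with `⟨S, u⟩ = ⟨T, u w⟩`. -/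
def vnAction {μ : Measure G} [μ.IsHaarMeasure] [μ.Regular] (w : fourierAlgebra μ)
    {T : Lp ℂ 2 μ →L[ℂ] Lp ℂ 2 μ} (hT : T ∈ groupVN μ) : Lp ℂ 2 μ →L[ℂ] Lp ℂ 2 μ :=
  -- The operator is defined by the bounded sesquilinear form (η, ξ) ↦ ⟨T, c w⟩, with c the
  -- coefficient function of ξ and η. The representation theorem places the operator on η, so the
  -- adjoint moves it to ξ.
  ContinuousLinearMap.adjoint (InnerProductSpace.continuousLinearMapOfBilin
    ((ContinuousLinearMap.compL ℂ (Lp ℂ 2 μ) (fourierAlgebra μ) ℂ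
      ((vnPairingL hT).comp ((fourierMul μ).flip w))).comp (coeffL μ)))

theorem inner_vnAction {μ : Measure G} [μ.IsHaarMeasure] [μ.Regular] (w : fourierAlgebra μ)
    {T : Lp ℂ 2 μ →L[ℂ] Lp ℂ 2 μ} (hT : T ∈ groupVN μ) (ξ η : Lp ℂ 2 μ) :
    inner ℂ η (vnAction w hT ξ) = vnPairing μ T (fourierMul μ (coeffFun μ ξ η) w) := by
  rw [vnAction, ContinuousLinearMap.adjoint_inner_right,
    InnerProductSpace.continuousLinearMapOfBilin_apply]
  rfl

theorem seqFunctional_vnAction {μ : Measure G} [μ.IsHaarMeasure] [μ.Regular]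
    (w : fourierAlgebra μ) {T : Lp ℂ 2 μ →L[ℂ] Lp ℂ 2 μ} (hT : T ∈ groupVN μ)
    {u : fourierAlgebra μ} {f g : ℕ → Lp ℂ 2 μ} (h : IsFourierRep μ u f g) :
    seqFunctional f g (vnAction w hT) = vnPairing μ T (fourierMul μ u w) := by
  have h1 := ((vnPairingL hT).comp ((fourierMul μ).flip w)).hasSum (IsFourierRep.hasSum h)
  rw [seqFunctional]
  simp only [inner_vnAction]
  exact h1.tsum_eq

/-- A functional `seqFunctional f g` that vanishes on the span of the λ(x) represents the zero
function of A(G). Its value at the new operator is then ⟨T, 0 · w⟩ = 0, and `mem_ultraweak_closure`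
applies. -/
theorem vnAction_mem {μ : Measure G} [μ.IsHaarMeasure] [μ.Regular]
    (w : fourierAlgebra μ) {T : Lp ℂ 2 μ →L[ℂ] Lp ℂ 2 μ} (hT : T ∈ groupVN μ) :
    vnAction w hT ∈ groupVN μ := by
  refine mem_ultraweak_closure fun f g h hz => ?_
  have hrep : IsFourierRep μ (0 : fourierAlgebra μ) f g := ⟨h, fun x =>
    (hz _ (Submodule.subset_span ⟨x, rfl⟩)).symm⟩
  rw [seqFunctional_vnAction w hT hrep]
  exact map_zero ((vnPairingL hT).comp ((fourierMul μ).flip w))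

theorem vnPairing_vnAction {μ : Measure G} [μ.IsHaarMeasure] [μ.Regular]
    (w : fourierAlgebra μ) {T : Lp ℂ 2 μ →L[ℂ] Lp ℂ 2 μ} (hT : T ∈ groupVN μ)
    (u : fourierAlgebra μ) : vnPairing μ (vnAction w hT) u = vnPairing μ T (fourierMul μ u w) := by
  have h := u.2.choose_spec.choose_spec
  rw [vnPairing_eq h (vnAction_mem w hT), seqFunctional_vnAction w hT h]

theorem norm_sum_inner_le {μ : Measure G} [μ.IsMulLeftInvariant] {k : ℕ}
    {T : Matrix (Fin k) (Fin k) (Lp ℂ 2 μ →L[ℂ] Lp ℂ 2 μ)} (hT : T ∈ vnMatrixBall μ k)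
    (ξ η : Fin k → Lp ℂ 2 μ) : ‖∑ i, ∑ j, inner ℂ (η i) (T i j (ξ j))‖ ≤
      √(∑ j, ‖ξ j‖ ^ 2) * √(∑ i, ‖η i‖ ^ 2) := by
  simp only [← inner_sum]
  calc _ ≤ ∑ i, ‖η i‖ * ‖∑ j, T i j (ξ j)‖ :=
        norm_sum_le_of_le _ fun i _ => norm_inner_le_norm _ _
    _ ≤ √(∑ i, ‖η i‖ ^ 2) * √(∑ i, ‖∑ j, T i j (ξ j)‖ ^ 2) :=
        Real.sum_mul_le_sqrt_mul_sqrt _ _ _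
    _ ≤ √(∑ i, ‖η i‖ ^ 2) * √(∑ j, ‖ξ j‖ ^ 2) := by
        exact mul_le_mul_of_nonneg_left (Real.sqrt_le_sqrt (hT.2 ξ)) (Real.sqrt_nonneg _)
    _ = _ := mul_comm _ _

theorem integrable_norm_mulTrans_sq (μ : Measure G) [μ.IsHaarMeasure] (f f' : C_c(G, ℂ)) :
    Integrable (fun t => ‖ccLp μ (ccMulTrans f f' t)‖ ^ 2) μ := by
  refine Continuous.integrable_of_hasCompactSupport
    ((continuous_ccLp_mulTrans μ f f').norm.pow 2)
    (HasCompactSupport.intro (isCompact_mulTransSupport f f') fun t ht => ?_)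
  rw [ccLp_mulTrans_eq_zero μ ht, norm_zero]
  exact zero_pow two_ne_zero

/-- By the integral formula the left side is an integral over t of the form of the matrix T at the
vectors ξ_j R_t f and η_i R_t g. For each t contractivity of T bounds it, and Cauchy–Schwarz in t
with `integral_norm_mulTrans_sq` finishes. -/
theorem norm_sum_pairing_ccLp_le (μ : Measure G) [μ.IsHaarMeasure] [μ.Regular] {k : ℕ}
    {T : Matrix (Fin k) (Fin k) (Lp ℂ 2 μ →L[ℂ] Lp ℂ 2 μ)} (hT : T ∈ vnMatrixBall μ k)
    (f g : C_c(G, ℂ)) (ξ η : Fin k → C_c(G, ℂ)) :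
    ‖∑ i, ∑ j, vnPairing μ (T i j) (fourierMul μ (coeffFun μ (ccLp μ (ξ j)) (ccLp μ (η i)))
      (coeffFun μ (ccLp μ f) (ccLp μ g)))‖ ≤
      ‖ccLp μ f‖ * ‖ccLp μ g‖ * (√(∑ j, ‖ccLp μ (ξ j)‖ ^ 2) * √(∑ i, ‖ccLp μ (η i)‖ ^ 2)) := by
  have hint : ∀ i j, Integrable (fun t => inner ℂ (ccLp μ (ccMulTrans (η i) g t))
      (T i j (ccLp μ (ccMulTrans (ξ j) f t)))) μ := fun i j => by
    have h := (vnPairingL (hT.1 i j)).integrable_comp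
      (integrable_coeffFun_mulTrans μ (ξ j) (η i) f g)
    refine h.congr (.of_forall fun t => ?_)
    exact vnPairing_coeffFun μ _ _ (hT.1 i j)
  have h1 : ∀ i j, vnPairing μ (T i j) (fourierMul μ (coeffFun μ (ccLp μ (ξ j)) (ccLp μ (η i)))
      (coeffFun μ (ccLp μ f) (ccLp μ g))) = ∫ t, inner ℂ (ccLp μ (ccMulTrans (η i) g t))
      (T i j (ccLp μ (ccMulTrans (ξ j) f t))) ∂μ := fun i j => by
    rw [fourierMul_ccLp]
    refine ((vnPairingL (hT.1 i j)).integral_comp_comm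
      (integrable_coeffFun_mulTrans μ (ξ j) (η i) f g)).symm.trans ?_
    refine integral_congr_ae (.of_forall fun t => ?_)
    exact vnPairing_coeffFun μ _ _ (hT.1 i j)
  have h2 : ∀ (ζ : Fin k → C_c(G, ℂ)) (f : C_c(G, ℂ)),
      ∫ t, √(∑ j, ‖ccLp μ (ccMulTrans (ζ j) f t)‖ ^ 2) ^ 2 ∂μ =
      ‖ccLp μ f‖ ^ 2 * ∑ j, ‖ccLp μ (ζ j)‖ ^ 2 := fun ζ f => by
    have hsq : ∀ t, √(∑ j, ‖ccLp μ (ccMulTrans (ζ j) f t)‖ ^ 2) ^ 2 =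
        ∑ j, ‖ccLp μ (ccMulTrans (ζ j) f t)‖ ^ 2 := fun t =>
      Real.sq_sqrt (Finset.sum_nonneg fun j _ => sq_nonneg _)
    rw [integral_congr_ae (.of_forall hsq), integral_finsetSum, Finset.mul_sum]
    · refine Finset.sum_congr rfl fun j _ => ?_
      rw [integral_norm_mulTrans_sq, mul_comm]
    · intro j _
      exact integrable_norm_mulTrans_sq μ (ζ j) f
  have hcont : ∀ (ζ : Fin k → C_c(G, ℂ)) (f : C_c(G, ℂ)),
      Continuous fun t => √(∑ j, ‖ccLp μ (ccMulTrans (ζ j) f t)‖ ^ 2) := fun ζ f =>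
    (continuous_finsetSum _ fun j _ => (continuous_ccLp_mulTrans μ (ζ j) f).norm.pow 2).sqrt
  have hsupp : ∀ (ζ : Fin k → C_c(G, ℂ)) (f : C_c(G, ℂ)),
      HasCompactSupport fun t => √(∑ j, ‖ccLp μ (ccMulTrans (ζ j) f t)‖ ^ 2) := fun ζ f => by
    refine HasCompactSupport.intro (isCompact_iUnion fun j => isCompact_mulTransSupport (ζ j) f)
      fun t ht => ?_
    rw [Real.sqrt_eq_zero', Finset.sum_eq_zero fun j _ => ?_]
    rw [ccLp_mulTrans_eq_zero μ fun h => ht (Set.mem_iUnion.2 ⟨j, h⟩), norm_zero]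
    simp
  simp only [h1]
  have h3 : ∑ i, ∑ j, ∫ t, inner ℂ (ccLp μ (ccMulTrans (η i) g t))
      (T i j (ccLp μ (ccMulTrans (ξ j) f t))) ∂μ =
      ∫ t, ∑ i, ∑ j, inner ℂ (ccLp μ (ccMulTrans (η i) g t))
      (T i j (ccLp μ (ccMulTrans (ξ j) f t))) ∂μ := by
    rw [integral_finsetSum _ fun i _ => integrable_finsetSum _ fun j _ => hint i j]
    exact Finset.sum_congr rfl fun i _ => (integral_finsetSum _ fun j _ => hint i j).symm
  rw [h3]
  calc _ ≤ ∫ t, √(∑ j, ‖ccLp μ (ccMulTrans (ξ j) f t)‖ ^ 2) *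
        √(∑ i, ‖ccLp μ (ccMulTrans (η i) g t)‖ ^ 2) ∂μ := by
        refine norm_integral_le_of_norm_le ?_ (.of_forall fun t => norm_sum_inner_le hT _ _)
        exact ((hcont ξ f).mul (hcont η g)).integrable_of_hasCompactSupport (hsupp ξ f).mul_right
    _ ≤ _ := integral_mul_le_sqrt μ (hcont ξ f) (hcont η g) (hsupp ξ f) (hsupp η g)
        (fun _ => Real.sqrt_nonneg _) fun _ => Real.sqrt_nonneg _
    _ = _ := by
      rw [h2, h2, Real.sqrt_mul (sq_nonneg _), Real.sqrt_mul (sq_nonneg _),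
        Real.sqrt_sq (norm_nonneg _), Real.sqrt_sq (norm_nonneg _)]
      ring

theorem norm_sum_pairing_coeffFun_le (μ : Measure G) [μ.IsHaarMeasure] [μ.Regular] {k : ℕ}
    {T : Matrix (Fin k) (Fin k) (Lp ℂ 2 μ →L[ℂ] Lp ℂ 2 μ)} (hT : T ∈ vnMatrixBall μ k)
    (f g : Lp ℂ 2 μ) (ξ η : Fin k → Lp ℂ 2 μ) :
    ‖∑ i, ∑ j, vnPairing μ (T i j) (fourierMul μ (coeffFun μ (ξ j) (η i)) (coeffFun μ f g))‖ ≤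
      ‖f‖ * ‖g‖ * (√(∑ j, ‖ξ j‖ ^ 2) * √(∑ i, ‖η i‖ ^ 2)) := by
  have hd := denseRange_ccLp μ
  have hdk : DenseRange fun (ζ : Fin k → C_c(G, ℂ)) i => ccLp μ (ζ i) :=
    DenseRange.piMap fun _ => hd
  refine ((hd.prodMap hd).prodMap (hdk.prodMap hdk)).induction_on
    (p := fun q : (Lp ℂ 2 μ × Lp ℂ 2 μ) × ((Fin k → Lp ℂ 2 μ) × (Fin k → Lp ℂ 2 μ)) =>
      ‖∑ i, ∑ j, vnPairing μ (T i j) (fourierMul μ (coeffFun μ (q.2.1 j) (q.2.2 i))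
        (coeffFun μ q.1.1 q.1.2))‖ ≤
      ‖q.1.1‖ * ‖q.1.2‖ * (√(∑ j, ‖q.2.1 j‖ ^ 2) * √(∑ i, ‖q.2.2 i‖ ^ 2)))
    ((f, g), (ξ, η)) (isClosed_le ?_ ?_) fun q => ?_
  · refine (continuous_finsetSum _ fun i _ => continuous_finsetSum _ fun j _ => ?_).norm
    have h1 : Continuous fun q : (Lp ℂ 2 μ × Lp ℂ 2 μ) × ((Fin k → Lp ℂ 2 μ) × (Fin k → Lp ℂ 2 μ)) =>
        (q.2.1 j, q.2.2 i) :=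
      ((continuous_apply j).comp (continuous_fst.comp continuous_snd)).prodMk
        ((continuous_apply i).comp (continuous_snd.comp continuous_snd))
    have h2 := (continuous_coeffFun μ).comp h1
    have h3 : Continuous fun q : (Lp ℂ 2 μ × Lp ℂ 2 μ) × ((Fin k → Lp ℂ 2 μ) ×
        (Fin k → Lp ℂ 2 μ)) => coeffFun μ q.1.1 q.1.2 :=
      (continuous_coeffFun μ).comp continuous_fst
    exact (vnPairingL (hT.1 i j)).continuous.comp (((fourierMul μ).continuous.comp h2).clm_apply h3)
  · have hn : ∀ (V : Type _) [NormedAddCommGroup V],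
        Continuous fun ζ : Fin k → V => √(∑ j, ‖ζ j‖ ^ 2) := fun V _ =>
      (continuous_finsetSum _ fun j _ => (continuous_apply j).norm.pow 2).sqrt
    have h1 := (hn (Lp ℂ 2 μ)).comp (continuous_fst.comp (continuous_snd
      (X := Lp ℂ 2 μ × Lp ℂ 2 μ) (Y := (Fin k → Lp ℂ 2 μ) × (Fin k → Lp ℂ 2 μ))))
    have h2 := (hn (Lp ℂ 2 μ)).comp (continuous_snd.comp (continuous_snd
      (X := Lp ℂ 2 μ × Lp ℂ 2 μ) (Y := (Fin k → Lp ℂ 2 μ) × (Fin k → Lp ℂ 2 μ))))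
    exact ((continuous_fst.comp continuous_fst).norm.mul
      (continuous_snd.comp continuous_fst).norm).mul (h1.mul h2)
  · exact norm_sum_pairing_ccLp_le μ hT q.1.1 q.1.2 q.2.1 q.2.2

/-- A representation of w with total weight below 1 sums the bounds for single coefficient functions
into a contractive bound on the sesquilinear form of the new matrix. -/
theorem vnAction_mem_ball {μ : Measure G} [μ.IsHaarMeasure] [μ.Regular] {k : ℕ}
    {T : Matrix (Fin k) (Fin k) (Lp ℂ 2 μ →L[ℂ] Lp ℂ 2 μ)} (hT : T ∈ vnMatrixBall μ k)
    {w : fourierAlgebra μ} (hw : ‖w‖ < 1) :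
    (fun i j => vnAction w (hT.1 i j)) ∈ vnMatrixBall μ k := by
  refine ⟨fun i j => vnAction_mem w _, fun ξ => ?_⟩
  obtain ⟨f, g, hrep, hlt⟩ := exists_rep_norm_lt w hw
  -- The form is tested against the image of ξ itself, giving ‖η‖² ≤ ‖ξ‖ ‖η‖.
  let η : Fin k → Lp ℂ 2 μ := fun i => ∑ j, vnAction w (hT.1 i j) (ξ j)
  have hbound : ‖∑ i, ∑ j, vnPairing μ (T i j) (fourierMul μ (coeffFun μ (ξ j) (η i)) w)‖ ≤
      1 * (√(∑ j, ‖ξ j‖ ^ 2) * √(∑ i, ‖η i‖ ^ 2)) := by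
    have hs : HasSum (fun n => ∑ i, ∑ j, vnPairing μ (T i j)
        (fourierMul μ (coeffFun μ (ξ j) (η i)) (coeffFun μ (f n) (g n))))
        (∑ i, ∑ j, vnPairing μ (T i j) (fourierMul μ (coeffFun μ (ξ j) (η i)) w)) :=
      hasSum_sum fun i _ => hasSum_sum fun j _ =>
        ((vnPairingL (hT.1 i j)).comp (fourierMul μ (coeffFun μ (ξ j) (η i)))).hasSum
          (IsFourierRep.hasSum hrep)
    have h1 := tsum_of_norm_bounded (hrep.summable.hasSum.mul_right
      (√(∑ j, ‖ξ j‖ ^ 2) * √(∑ i, ‖η i‖ ^ 2)))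
      fun n => norm_sum_pairing_coeffFun_le μ hT (f n) (g n) ξ η
    rw [hs.tsum_eq] at h1
    exact h1.trans (mul_le_mul_of_nonneg_right hlt.le (by positivity))
  have heq : ∑ i, ∑ j, vnPairing μ (T i j) (fourierMul μ (coeffFun μ (ξ j) (η i)) w) =
      ((∑ i, ‖η i‖ ^ 2 : ℝ) : ℂ) := by
    rw [Complex.ofReal_sum]
    refine Finset.sum_congr rfl fun i _ => ?_
    have hin : ∀ j, vnPairing μ (T i j) (fourierMul μ (coeffFun μ (ξ j) (η i)) w) =
        inner ℂ (η i) (vnAction w (hT.1 i j) (ξ j)) := fun j => (inner_vnAction _ _ _ _).symm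
    rw [Finset.sum_congr rfl fun j _ => hin j, ← inner_sum]
    refine (inner_self_eq_norm_sq_to_K (𝕜 := ℂ) (η i)).trans ?_
    push_cast
    rfl
  have hη : 0 ≤ ∑ i, ‖η i‖ ^ 2 := Finset.sum_nonneg fun i _ => by positivity
  have hξ : 0 ≤ ∑ i, ‖ξ i‖ ^ 2 := Finset.sum_nonneg fun i _ => by positivity
  rw [heq, Complex.norm_real, Real.norm_of_nonneg hη, one_mul] at hbound
  change ∑ i, ‖η i‖ ^ 2 ≤ ∑ j, ‖ξ j‖ ^ 2
  by_contra! hcon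
  have h2 : √(∑ j, ‖ξ j‖ ^ 2) < √(∑ i, ‖η i‖ ^ 2) := Real.sqrt_lt_sqrt hξ hcon
  have h3 : 0 < √(∑ i, ‖η i‖ ^ 2) := (Real.sqrt_nonneg _).trans_lt h2
  have h4 := mul_lt_mul_of_pos_right h2 h3
  rw [Real.mul_self_sqrt hη] at h4
  exact absurd hbound (not_le.2 h4)

/-- Duality: pairing T with w u is pairing w · T with u, and w · T stays in the matrix unit ball
over which the norm is a supremum. -/
theorem isCBBound_fourierMul_one {μ : Measure G} [μ.IsHaarMeasure] [μ.Regular]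
    {w : fourierAlgebra μ} (hw : ‖w‖ < 1) : IsCBBound μ (fourierMul μ w) 1 := by
  refine ⟨zero_le_one, fun n u => ?_⟩
  rw [ENNReal.ofReal_one, one_mul]
  refine iSup_le fun k => iSup₂_le fun T hT => ?_
  have h : pairingMatrix μ T (u.map (fourierMul μ w)) =
      pairingMatrix μ (fun i j => vnAction w (hT.1 i j)) u := by
    ext p q
    simp only [pairingMatrix, Matrix.of_apply, Matrix.map_apply]
    rw [vnPairing_vnAction, fourierMul_comm]
  rw [h]
  exact le_iSup_of_le k (le_iSup₂_of_le _ (vnAction_mem_ball hT hw) le_rfl)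

theorem isCBBound_fourierMul {μ : Measure G} [μ.IsHaarMeasure] [μ.Regular]
    {w : fourierAlgebra μ} {r : ℝ} (hw : ‖w‖ < r) : IsCBBound μ (fourierMul μ w) r := by
  have hr : 0 < r := (norm_nonneg w).trans_lt hw
  have h1 : ‖((r⁻¹ : ℝ) : ℂ) • w‖ < 1 := by
    rw [norm_smul, Complex.norm_real, Real.norm_of_nonneg (inv_nonneg.2 hr.le), inv_mul_lt_iff₀ hr,
      mul_one]
    exact hw
  have h2 := (isCBBound_fourierMul_one h1).smul (r : ℂ)
  have h3 : (r : ℂ) * (r : ℂ)⁻¹ = 1 := mul_inv_cancel₀ (Complex.ofReal_ne_zero.2 hr.ne')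
  rw [map_smul, smul_smul, Complex.ofReal_inv, h3, one_smul, Complex.norm_real,
    Real.norm_of_nonneg hr.le, mul_one] at h2
  exact h2

end Fourier

end FourierAlg

namespace FourierAlg

/-! ### Transfer to MA(G), M_cb A(G) and the closures of A(G) in them -/

section Fourier

variable {G : Type*} [Group G] [TopologicalSpace G] [IsTopologicalGroup G]
  [MeasurableSpace G] [BorelSpace G] [LocallyCompactSpace G]

theorem mem_multiplierCarrier {μ : Measure G} [μ.IsHaarMeasure] [μ.Regular]
    (u : fourierAlgebra μ) : (u : G → ℂ) ∈ multiplierCarrier μ :=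
  ⟨fourierAlgebra_continuous u, ⟨‖u‖, (fourierAlgebra μ).norm_apply_le u⟩, fourierMul μ u,
    fun v x => fourierMul_apply u v x⟩

theorem multiplierOp_eq_fourierMul {μ : Measure G} [μ.IsHaarMeasure] [μ.Regular]
    (u : fourierAlgebra μ) {v : multiplierCarrier μ} (h : (v : G → ℂ) = u) :
    multiplierOp μ v = fourierMul μ u :=
  fourierAlgebra_op_ext fun w x => by rw [multiplierOp_apply, fourierMul_apply, h]

theorem mul_mem_multiplierCarrier {μ : Measure G} [μ.IsHaarMeasure] (u v : multiplierCarrier μ) :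
    (u : G → ℂ) * v ∈ multiplierCarrier μ := by
  obtain ⟨C, hC⟩ := u.2.2.1
  obtain ⟨D, hD⟩ := v.2.2.1
  refine ⟨u.2.1.mul v.2.1, ⟨C * D, fun x => ?_⟩, (multiplierOp μ u).comp (multiplierOp μ v),
    fun w x => ?_⟩
  · rw [Pi.mul_apply, norm_mul]
    exact mul_le_mul (hC x) (hD x) (norm_nonneg _) ((norm_nonneg _).trans (hC x))
  · rw [ContinuousLinearMap.comp_apply, multiplierOp_apply, multiplierOp_apply, Pi.mul_apply,
      mul_assoc]

theorem multiplierOp_mul {μ : Measure G} [μ.IsHaarMeasure] (u v : multiplierCarrier μ) :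
    multiplierOp μ ⟨(u : G → ℂ) * v, mul_mem_multiplierCarrier u v⟩ =
      (multiplierOp μ u).comp (multiplierOp μ v) :=
  fourierAlgebra_op_ext fun w x => by
    rw [ContinuousLinearMap.comp_apply, multiplierOp_apply, multiplierOp_apply, multiplierOp_apply]
    exact mul_assoc _ _ _

theorem IsCBBound.comp {μ : Measure G} [μ.IsHaarMeasure]
    {L M : fourierAlgebra μ →L[ℂ] fourierAlgebra μ} {C D : ℝ} (h : IsCBBound μ L C)
    (h' : IsCBBound μ M D) : IsCBBound μ (L.comp M) (C * D) := by
  refine ⟨mul_nonneg h.1 h'.1, fun n w => ?_⟩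
  rw [ENNReal.ofReal_mul h.1, mul_assoc]
  refine (h.2 n (w.map M)).trans ?_
  gcongr
  exact h'.2 n w

/-- A normed algebra of functions that contains `A(G)`, with a smaller norm. -/
structure IsFourierExtension (μ : Measure G) [μ.IsHaarMeasure] (E : FunctionSpace G) : Prop where
  exists_mul : ∀ u v : E, ∃ p : E, (∀ y, p y = u y * v y) ∧ ‖p‖ ≤ ‖u‖ * ‖v‖
  exists_of_fourier : ∀ u : fourierAlgebra μ, ∃ v : E, (∀ y, v y = u y) ∧ ‖v‖ ≤ ‖u‖

theorem isFourierExtension_fourierAlgebra (μ : Measure G) [μ.IsHaarMeasure] [μ.Regular] :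
    IsFourierExtension μ (fourierAlgebra μ) :=
  ⟨exists_fourierAlgebra_mul, fun u => ⟨u, fun _ => rfl, le_rfl⟩⟩

theorem isFourierExtension_multiplierAlgebra (μ : Measure G) [μ.IsHaarMeasure] [μ.Regular] :
    IsFourierExtension μ (multiplierAlgebra μ) where
  exists_mul u v := by
    refine ⟨⟨_, mul_mem_multiplierCarrier u v⟩, fun y => rfl, ?_⟩
    exact (congrArg norm (multiplierOp_mul u v)).trans_le
      (ContinuousLinearMap.opNorm_comp_le _ _)
  exists_of_fourier u := by
    refine ⟨⟨u, mem_multiplierCarrier u⟩, fun y => rfl, ?_⟩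
    refine (congrArg norm (multiplierOp_eq_fourierMul u rfl)).trans_le ?_
    exact ContinuousLinearMap.opNorm_le_bound _ (norm_nonneg u) (norm_fourierMul_le u)

theorem norm_cbMultiplierAlgebra_le {μ : Measure G} [μ.IsHaarMeasure] (v : cbMultiplierAlgebra μ)
    {C : ℝ} {L : fourierAlgebra μ →L[ℂ] fourierAlgebra μ} (hL : ∀ w x, L w x = v x * w x)
    (h : IsCBBound μ L C) : ‖v‖ ≤ C := by
  refine cbNormFun_le ?_
  convert h
  exact fourierAlgebra_op_ext fun w x => (multiplierOp_apply _ w x).trans (hL w x).symm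

theorem exists_isCBBound_lt {μ : Measure G} [μ.IsHaarMeasure] (v : cbMultiplierAlgebra μ) {r : ℝ}
    (hr : ‖v‖ < r) : ∃ L C, (∀ w x, L w x = v x * w x) ∧ IsCBBound μ L C ∧ C < r := by
  obtain ⟨C, hC, hlt⟩ := exists_cbBound_lt (cbMultiplierOp μ v).2 hr
  exact ⟨_, C, fun w x => multiplierOp_apply _ w x, hC, hlt⟩

theorem mem_cbMultiplierCarrier {μ : Measure G} [μ.IsHaarMeasure] {v : G → ℂ}
    (hv : v ∈ multiplierCarrier μ) {C : ℝ} {L : fourierAlgebra μ →L[ℂ] fourierAlgebra μ}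
    (hL : ∀ w x, L w x = v x * w x) (h : IsCBBound μ L C) : v ∈ cbMultiplierCarrier μ := by
  refine ⟨⟨v, hv⟩, ⟨C, ?_⟩, rfl⟩
  convert h
  exact fourierAlgebra_op_ext fun w x => (multiplierOp_apply _ w x).trans (hL w x).symm

theorem isFourierExtension_cbMultiplierAlgebra (μ : Measure G) [μ.IsHaarMeasure] [μ.Regular] :
    IsFourierExtension μ (cbMultiplierAlgebra μ) where
  exists_mul u v := by
    have key : ∀ r s, ‖u‖ < r → ‖v‖ < s → ∃ p : cbMultiplierAlgebra μ,
        (∀ y, p y = u y * v y) ∧ ‖p‖ ≤ r * s := by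
      intro r s hr hs
      obtain ⟨L, C, hL, hC, hlt⟩ := exists_isCBBound_lt u hr
      obtain ⟨M, D, hM, hD, hlt'⟩ := exists_isCBBound_lt v hs
      have hLM : ∀ w x, L.comp M w x = (u x * v x) * w x := fun w x => by
        rw [ContinuousLinearMap.comp_apply, hL, hM, mul_assoc]
      have hmem : (fun x => u x * v x) ∈ multiplierCarrier μ :=
        mul_mem_multiplierCarrier (Submodule.inclusion (cbMultiplierCarrier_le μ) u)
          (Submodule.inclusion (cbMultiplierCarrier_le μ) v)
      refine ⟨⟨_, mem_cbMultiplierCarrier hmem hLM (hC.comp hD)⟩, fun y => rfl, ?_⟩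
      refine (norm_cbMultiplierAlgebra_le _ hLM (hC.comp hD)).trans ?_
      exact mul_le_mul hlt.le hlt'.le hD.1 (hC.1.trans hlt.le)
    obtain ⟨p, hp, -⟩ := key _ _ (lt_add_one ‖u‖) (lt_add_one ‖v‖)
    refine ⟨p, hp, ?_⟩
    have hlim : Tendsto (fun ε : ℝ => (‖u‖ + ε) * (‖v‖ + ε)) (𝓝[>] 0) (𝓝 (‖u‖ * ‖v‖)) := by
      have : Continuous fun ε : ℝ => (‖u‖ + ε) * (‖v‖ + ε) := by fun_prop
      simpa using (this.tendsto 0).mono_left nhdsWithin_le_nhds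
    refine ge_of_tendsto hlim (eventually_mem_nhdsWithin.mono fun ε hε => ?_)
    obtain ⟨p', hp', hle⟩ := key _ _ (lt_add_of_pos_right ‖u‖ hε) (lt_add_of_pos_right ‖v‖ hε)
    rwa [show p = p' from FunctionSpace.Elem.ext fun y => (hp y).trans (hp' y).symm]
  exists_of_fourier u := by
    have h : ∀ w x, fourierMul μ u w x = u x * w x := fun w x => fourierMul_apply u w x
    refine ⟨⟨u, mem_cbMultiplierCarrier (mem_multiplierCarrier u) h
      (isCBBound_fourierMul (lt_add_one ‖u‖))⟩, fun y => rfl, ?_⟩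
    refine le_of_forall_gt_imp_ge_of_dense fun r hr => ?_
    exact norm_cbMultiplierAlgebra_le _ h (isCBBound_fourierMul hr)

/-- The submultiplicativity of the norm, and the existence of functions of norm one in `𝒜` that are
concentrated at a given point. -/
structure HasPointUnits {G : Type*} (𝒜 : FunctionSpace G) : Prop where
  norm_le_mul : ∀ u v w : 𝒜, (∀ y, w y = u y * v y) → ‖w‖ ≤ ‖u‖ * ‖v‖
  exists_unit : ∀ (x : G) (F : Finset 𝒜) (ε : ℝ), 0 < ε → ∃ e : 𝒜, ‖e‖ ≤ 1 ∧ e x = 1 ∧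
    ∀ u ∈ F, ∀ w : 𝒜, (∀ y, w y = e y * u y - u x * e y) → ‖w‖ ≤ ε

/-- The hypotheses say that 𝒜 sits isometrically in E, contains A(G), and is approximated by A(G) in
the norm of E. The concentrated functions of A(G) keep norm at most 1 in E, so only the
approximation of each u by some a in A(G) costs anything. -/
theorem IsFourierExtension.hasPointUnits {μ : Measure G} [μ.IsHaarMeasure] [μ.Regular]
    {E 𝒜 : FunctionSpace G} (hE : IsFourierExtension μ E)
    (hlift : ∀ u : 𝒜, ∃ v : E, (∀ y, v y = u y) ∧ ‖v‖ = ‖u‖ ∧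
      ∀ ε, 0 < ε → ∃ (a : fourierAlgebra μ) (b : E), (∀ y, b y = a y) ∧ ‖v - b‖ < ε)
    (hdesc : ∀ (a : fourierAlgebra μ) (b : E), (∀ y, b y = a y) → ∃ u : 𝒜, ∀ y, u y = a y) :
    HasPointUnits 𝒜 := by
  have hnorm : ∀ (u : 𝒜) (v : E), (∀ y, v y = u y) → ‖v‖ = ‖u‖ := fun u v h => by
    obtain ⟨v', hv', hn, -⟩ := hlift u
    rw [← hn, show v = v' from FunctionSpace.Elem.ext fun y => (h y).trans (hv' y).symm]
  refine ⟨fun u v w h => ?_, fun x F ε hε => ?_⟩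
  · obtain ⟨u', hu', hnu, -⟩ := hlift u
    obtain ⟨v', hv', hnv, -⟩ := hlift v
    obtain ⟨p, hp, hle⟩ := hE.exists_mul u' v'
    rw [← hnorm w p fun y => by rw [hp, hu', hv', h], ← hnu, ← hnv]
    exact hle
  · classical
    choose l hl hln happ using hlift
    choose a b hba hlt using fun u => happ u (ε / 3) (by positivity)
    obtain ⟨e, he, hex, heF⟩ := exists_coeffAt μ x (F.image a) (ε := ε / 3) (by positivity)
    obtain ⟨e', he', hle'⟩ := hE.exists_of_fourier e
    obtain ⟨d, hd⟩ := hdesc e e' he'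
    have hde : ∀ y, e' y = d y := fun y => (he' y).trans (hd y).symm
    refine ⟨d, ?_, (hd x).trans hex, fun u hu w hw => ?_⟩
    · rw [← hnorm d e' hde]
      exact hle'.trans he
    · obtain ⟨p, hp, hpn⟩ := hE.exists_mul e' (l u - b u)
      obtain ⟨q, hq, hqn⟩ := hE.exists_of_fourier (fourierMul μ e (a u) - a u x • e)
      -- Decomposition e u - u(x) e = e (u - a) + (e a - a(x) e) - (u - a)(x) e, with each of the
      -- three terms at most ε/3.
      have h1 : ‖p + q - (l u - b u) x • e'‖ = ‖w‖ := hnorm w _ fun y => by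
        simp only [FunctionSpace.add_apply, FunctionSpace.sub_apply, FunctionSpace.smul_apply,
          hp, hq, hw, hl, hba, he', hd, fourierMul_apply]
        ring
      have h2 : ‖p‖ ≤ ε / 3 := hpn.trans
        ((mul_le_of_le_one_left (norm_nonneg _) (hle'.trans he)).trans (hlt u).le)
      have h3 : ‖q‖ ≤ ε / 3 := hqn.trans (heF _ (Finset.mem_image_of_mem a hu))
      have h4 : ‖(l u - b u) x • e'‖ ≤ ε / 3 := by
        rw [norm_smul]
        exact (mul_le_of_le_one_right (norm_nonneg _) (hle'.trans he)).trans
          ((E.norm_apply_le _ x).trans (hlt u).le)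
      rw [← h1]
      have h5 := norm_sub_le (p + q) ((l u - b u) x • e')
      have h6 := norm_add_le p q
      linarith

theorem IsFourierExtension.hasPointUnits_closureOf {μ : Measure G} [μ.IsHaarMeasure] [μ.Regular]
    {E : FunctionSpace G} (hE : IsFourierExtension μ E) :
    HasPointUnits (E.closureOf (fourierCarrier μ)) := by
  refine hE.hasPointUnits (fun u => ?_) fun a b hb => ?_
  · obtain ⟨v, hv, hvu⟩ := u.2
    refine ⟨v, fun y => congrFun hvu y, ?_, fun ε hε => ?_⟩
    · exact congrArg E.nrm (Subtype.ext hvu)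
    · obtain ⟨b, hb, hd⟩ := Metric.mem_closure_iff.1 hv ε hε
      exact ⟨⟨b, hb⟩, b, fun y => rfl, by rwa [← dist_eq_norm]⟩
  · have hba : E.toFun b = a := funext hb
    refine ⟨⟨E.toFun b, b, Submodule.le_topologicalClosure _ ?_, rfl⟩, hb⟩
    rw [Submodule.mem_comap, hba]
    exact a.2

theorem hasPointUnits_fourierAlgebra (μ : Measure G) [μ.IsHaarMeasure] [μ.Regular] :
    HasPointUnits (fourierAlgebra μ) :=
  (isFourierExtension_fourierAlgebra μ).hasPointUnits
    (fun u => ⟨u, fun _ => rfl, rfl, fun ε hε => ⟨u, u, fun _ => rfl, by simpa using hε⟩⟩)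
    fun a _ _ => ⟨a, fun _ => rfl⟩

end Fourier

end FourierAlg

namespace FourierAlg

/-! ### The module I* and the extension of invariant means -/

namespace ClosedIdeal

variable {G : Type*} {𝒜 : FunctionSpace G}

/-- The inclusion of a closed ideal. -/
def incl (I : ClosedIdeal 𝒜) (u : I.toSpace) : 𝒜 := ⟨u.1, I.le u.2⟩

@[simp] theorem incl_apply (I : ClosedIdeal 𝒜) (u : I.toSpace) (y : G) : I.incl u y = u y := rfl

@[simp] theorem mul_apply (I : ClosedIdeal 𝒜) (u v : I.toSpace) (y : G) :
    I.mul u v y = u y * v y := rfl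

theorem norm_mul_le {I : ClosedIdeal 𝒜} (h𝒜 : HasPointUnits 𝒜) (u v : I.toSpace) :
    ‖I.mul u v‖ ≤ ‖u‖ * ‖v‖ :=
  h𝒜.norm_le_mul (I.incl u) (I.incl v) (I.incl (I.mul u v)) fun _ => rfl

/-- The operator `v ↦ v u` on a closed ideal. -/
def mulRight (I : ClosedIdeal 𝒜) (h𝒜 : HasPointUnits 𝒜) (u : I.toSpace) :
    I.toSpace →L[ℂ] I.toSpace :=
  LinearMap.mkContinuous
    { toFun := fun v => I.mul v u
      map_add' := fun v w => FunctionSpace.Elem.ext fun y => by simp [add_mul]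
      map_smul' := fun c v => FunctionSpace.Elem.ext fun y => by simp [mul_assoc] } ‖u‖
    fun v => (norm_mul_le h𝒜 v u).trans_eq (mul_comm _ _)

@[simp] theorem mulRight_apply (I : ClosedIdeal 𝒜) (h𝒜 : HasPointUnits 𝒜) (u v : I.toSpace) :
    I.mulRight h𝒜 u v = I.mul v u := rfl

/-- The functional `u · T`. -/
def act (I : ClosedIdeal 𝒜) (h𝒜 : HasPointUnits 𝒜) (u : I.toSpace) (T : NormedDual I.toSpace) :
    NormedDual I.toSpace := T.comp (I.mulRight h𝒜 u)

@[simp] theorem act_apply (I : ClosedIdeal 𝒜) (h𝒜 : HasPointUnits 𝒜) (u v : I.toSpace)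
    (T : NormedDual I.toSpace) : I.act h𝒜 u T v = T (I.mul v u) := rfl

/-- Submultiplicativity of the norm turns the relation into a genuine bounded action, so the
functional u · T exists and is unique. -/
theorem isAction_iff {I : ClosedIdeal 𝒜} (h𝒜 : HasPointUnits 𝒜) {u : I.toSpace}
    {T S : NormedDual I.toSpace} : I.IsAction u T S ↔ S = I.act h𝒜 u T :=
  ⟨fun h => ContinuousLinearMap.ext h, fun h v => by rw [h, act_apply]⟩

theorem norm_act_le (I : ClosedIdeal 𝒜) (h𝒜 : HasPointUnits 𝒜) (u : I.toSpace)
    (T : NormedDual I.toSpace) : ‖I.act h𝒜 u T‖ ≤ ‖u‖ * ‖T‖ := by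
  refine (ContinuousLinearMap.opNorm_comp_le _ _).trans ?_
  rw [mul_comm]
  gcongr
  exact LinearMap.mkContinuous_norm_le _ (norm_nonneg u) _

/-- The operator `T ↦ u · T`. -/
def actL (I : ClosedIdeal 𝒜) (h𝒜 : HasPointUnits 𝒜) (u : I.toSpace) :
    NormedDual I.toSpace →L[ℂ] NormedDual I.toSpace :=
  LinearMap.mkContinuous
    { toFun := I.act h𝒜 u
      map_add' := fun _ _ => rfl
      map_smul' := fun _ _ => rfl } ‖u‖ (I.norm_act_le h𝒜 u)

theorem act_act (I : ClosedIdeal 𝒜) (h𝒜 : HasPointUnits 𝒜) (u v : I.toSpace)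
    (T : NormedDual I.toSpace) : I.act h𝒜 u (I.act h𝒜 v T) = I.act h𝒜 (I.mul u v) T :=
  ContinuousLinearMap.ext fun w => by
    simp only [act_apply]
    congr 1
    exact FunctionSpace.Elem.ext fun y => by simp [mul_assoc]

theorem act_sub_smul (I : ClosedIdeal 𝒜) (h𝒜 : HasPointUnits 𝒜) (u v : I.toSpace) (c : ℂ)
    (T : NormedDual I.toSpace) :
    I.act h𝒜 (u - c • v) T = I.act h𝒜 u T - c • I.act h𝒜 v T :=
  ContinuousLinearMap.ext fun w => by
    change T _ = T _ - c • T _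
    rw [← map_smul, ← map_sub]
    congr 1
    exact FunctionSpace.Elem.ext fun y => by simp; ring

theorem norm_eval_le {E : FunctionSpace G} (x : G) : ‖E.eval x‖ ≤ 1 :=
  LinearMap.mkContinuous_norm_le _ zero_le_one _

/-- Elements `v` of `E` with `v(x) = 1` and norm close to one. -/
theorem exists_apply_eq_one {E : FunctionSpace G} {x : G} (h : 1 ≤ ‖E.eval x‖) {ε : ℝ}
    (hε : 0 < ε) : ∃ v : E, v x = 1 ∧ ‖v‖ ≤ 1 + ε := by
  have h1 : (1 + ε)⁻¹ < ‖E.eval x‖ := (inv_lt_one_of_one_lt₀ (by linarith)).trans_le h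
  obtain ⟨v, hv⟩ : ∃ v : E, (1 + ε)⁻¹ * ‖v‖ < ‖v x‖ := by
    by_contra! hcon
    exact not_le.2 h1 (ContinuousLinearMap.opNorm_le_bound _ (by positivity) hcon)
  have hvx : 0 < ‖v x‖ := lt_of_le_of_lt (by positivity) hv
  refine ⟨(v x)⁻¹ • v, ?_, ?_⟩
  · rw [FunctionSpace.smul_apply, inv_mul_cancel₀ (norm_pos_iff.1 hvx)]
  · rw [norm_smul, norm_inv, inv_mul_le_iff₀ hvx]
    rw [inv_mul_lt_iff₀ (by positivity)] at hv
    linarith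

/-- A concentrated e from 𝒜 is moved into the ideal by multiplying it with some v in I with v(x) =
1. -/
theorem exists_concentrated {I : ClosedIdeal 𝒜} (h𝒜 : HasPointUnits 𝒜) {x : G}
    (h : 1 ≤ ‖I.toSpace.eval x‖) (F : Finset I.toSpace) {ε : ℝ} (hε : 0 < ε) :
    ∃ d : I.toSpace, d x = 1 ∧ ‖d‖ ≤ 1 + ε ∧ ∀ u ∈ F, ‖I.mul d u - u x • d‖ ≤ ε := by
  classical
  obtain ⟨v, hvx, hv⟩ := exists_apply_eq_one h hε
  -- Since z(x) = 0, the difference e z - z(x) e is just e z, and this equals d u - u(x) d.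
  let z : I.toSpace → I.toSpace := fun u => I.mul v u - u x • v
  have hzx : ∀ u, z u x = 0 := fun u => by simp [z, hvx]
  obtain ⟨e, he, hex, heF⟩ := h𝒜.exists_unit x (F.image fun u => I.incl (z u)) ε hε
  let d : I.toSpace := ⟨(e : G → ℂ) * v, I.mul_mem e e.2 v v.2⟩
  have hd : ∀ y, d y = e y * v y := fun y => rfl
  refine ⟨d, by rw [hd, hex, hvx, one_mul], ?_, fun u hu => ?_⟩
  · refine (h𝒜.norm_le_mul e (I.incl v) (I.incl d) hd).trans ?_
    exact (mul_le_of_le_one_left (norm_nonneg _) he).trans hv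
  · refine heF _ (Finset.mem_image_of_mem _ hu) (I.incl (I.mul d u - u x • d)) fun y => ?_
    rw [incl_apply, incl_apply, incl_apply, hzx, zero_mul, sub_zero]
    simp only [z, FunctionSpace.sub_apply, mul_apply, FunctionSpace.smul_apply, hd]
    ring

/-- The extension of an invariant mean to the whole of `I*`. -/
theorem exists_extension {I : ClosedIdeal 𝒜} (h𝒜 : HasPointUnits 𝒜) {x : G}
    {Y : Submodule ℂ (NormedDual I.toSpace)} (hY : I.IsClosedSubmodule Y)
    (hφY : I.toSpace.eval x ∈ Y) {m : NormedDual Y} (hm : I.IsTIM Y x hφY m) :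
    ∃ M : StrongDual ℂ (NormedDual I.toSpace), ‖M‖ ≤ 1 ∧
      (∀ u T, M (I.act h𝒜 u T) = u x * M T) ∧ ∀ T (hT : T ∈ Y), M T = m ⟨T, hT⟩ := by
  classical
  -- The given mean bounds the norm of φ_x on the ideal from below.
  have hφ : 1 ≤ ‖I.toSpace.eval x‖ := by
    have h := m.le_opNorm ⟨I.toSpace.eval x, hφY⟩
    rwa [hm.apply_eval, hm.norm_eq, one_mul, norm_one] at h
  obtain ⟨M₀, hM₀, hM₀n⟩ := exists_extension_norm_eq Y m
  rw [hm.norm_eq] at hM₀n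
  have hεpos : ∀ n : ℕ, (0 : ℝ) < 1 / ((n : ℝ) + 1) := fun n => Nat.one_div_pos_of_nat
  choose d hdx hdn hdF using fun p : Finset I.toSpace × ℕ =>
    exists_concentrated h𝒜 hφ p.1 (hεpos p.2)
  let N : Finset I.toSpace × ℕ → StrongDual ℂ (NormedDual I.toSpace) :=
    fun p => M₀.comp (I.actL h𝒜 (d p))
  have hN : ∀ p T, N p T = M₀ (I.act h𝒜 (d p) T) := fun p T => rfl
  have hM₀le : ∀ T, ‖M₀ T‖ ≤ ‖T‖ := fun T => by
    have h := M₀.le_opNorm T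
    rwa [hM₀n, one_mul] at h
  have hNle : ∀ p T, ‖N p T‖ ≤ (1 + 1 / ((p.2 : ℝ) + 1)) * ‖T‖ := fun p T => by
    rw [hN]
    refine (hM₀le _).trans ((I.norm_act_le h𝒜 _ _).trans ?_)
    gcongr
    exact hdn p
  let 𝒰 : Ultrafilter (Finset I.toSpace × ℕ) := Ultrafilter.of atTop
  have h𝒰 : (𝒰 : Filter (Finset I.toSpace × ℕ)) ≤ atTop := Ultrafilter.of_le _
  -- Radius 2 suffices because ‖d‖ ≤ 1 + 1/(n+1) ≤ 2; the sharp bound 1 is recovered in the limit.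
  -- An ultrafilter finer than `atTop` yields one limit for all T at once.
  obtain ⟨M, -, hM⟩ := (WeakDual.isCompact_closedBall (𝕜 := ℂ)
    (0 : StrongDual ℂ (NormedDual I.toSpace)) 2).ultrafilter_le_nhds
    (𝒰.map fun p => StrongDual.toWeakDual (N p)) (by
      rw [le_principal_iff]
      refine Filter.Eventually.of_forall (f := (𝒰 : Filter (Finset I.toSpace × ℕ))) fun p => ?_
      change N p ∈ Metric.closedBall 0 2
      refine (dist_zero_right (N p)).trans_le ?_
      refine ContinuousLinearMap.opNorm_le_bound _ zero_le_two fun T => (hNle p T).trans ?_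
      gcongr
      have : 1 / ((p.2 : ℝ) + 1) ≤ 1 := by
        rw [div_le_one (by positivity)]
        linarith [p.2.cast_nonneg (α := ℝ)]
      linarith)
  have hlim : ∀ T, Tendsto (fun p => N p T) 𝒰 (𝓝 (M T)) := fun T =>
    ((WeakDual.eval_continuous T).tendsto M).comp hM
  have hε : Tendsto (fun p : Finset I.toSpace × ℕ => 1 / ((p.2 : ℝ) + 1)) 𝒰 (𝓝 0) := by
    refine Tendsto.mono_left ?_ h𝒰
    rw [← prod_atTop_atTop_eq]
    exact tendsto_one_div_add_atTop_nhds_zero_nat.comp tendsto_snd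
  refine ⟨WeakDual.toStrongDual M, ?_, fun u T => ?_, fun T hT => ?_⟩
  · refine ContinuousLinearMap.opNorm_le_bound _ zero_le_one fun T => ?_
    have h1 : Tendsto (fun p : Finset I.toSpace × ℕ => (1 + 1 / ((p.2 : ℝ) + 1)) * ‖T‖) 𝒰
        (𝓝 (1 * ‖T‖)) := by
      simpa using (hε.const_add 1).mul_const ‖T‖
    exact le_of_tendsto_of_tendsto (hlim T).norm h1 (.of_forall fun p => hNle p T)
  · change M (I.act h𝒜 u T) = u x * M T
    rw [← sub_eq_zero]
    refine tendsto_nhds_unique ((hlim (I.act h𝒜 u T)).sub ((hlim T).const_mul (u x))) ?_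
    have h1 := hε.mul_const ‖T‖
    rw [zero_mul] at h1
    refine squeeze_zero_norm' ?_ h1
    -- Far along the index set the finite set contains u, so d nearly absorbs it.
    filter_upwards [h𝒰 (mem_atTop (({u} : Finset I.toSpace), 0))] with p hp
    have hup : u ∈ p.1 := hp.1 (Finset.mem_singleton_self u)
    have h2 : N p (I.act h𝒜 u T) - u x * N p T =
        M₀ (I.act h𝒜 (I.mul (d p) u - u x • d p) T) := by
      rw [hN, hN, act_act, act_sub_smul, map_sub, map_smul, smul_eq_mul]
    rw [h2]
    refine (hM₀le _).trans ((I.norm_act_le h𝒜 _ _).trans ?_)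
    gcongr
    exact hdF p u hup
  -- On Y the approximants do not depend on the index: M₀ agrees with m there, and d(x) = 1.
  · refine tendsto_nhds_unique (hlim T) (tendsto_const_nhds.congr fun p => ?_)
    obtain ⟨S, hS, hact⟩ := hY.action_mem (d p) T hT
    have h1 := hm.invariant (d p) ⟨T, hT⟩ ⟨S, hS⟩ hact
    rw [hdx, one_mul] at h1
    rw [hN, ← (isAction_iff h𝒜).1 hact, ← h1]
    exact (hM₀ ⟨S, hS⟩).symm

end ClosedIdeal

end FourierAlg

end

theorem mainTheorem10 {G : Type*} [Group G] [TopologicalSpace G] [IsTopologicalGroup G]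
    [LocallyCompactSpace G] [T2Space G] [MeasurableSpace G] [BorelSpace G]
    (μ : Measure G) [μ.IsHaarMeasure] [μ.Regular]
    (𝒜 : FourierAlg.FunctionSpace G)
    (h𝒜 : 𝒜 = FourierAlg.fourierAlgebra μ ∨ 𝒜 = FourierAlg.fourierCB μ ∨
      𝒜 = FourierAlg.fourierM μ)
    (I : FourierAlg.ClosedIdeal 𝒜)
    (hI : FourierAlg.IsSpectralSynthesis 𝒜 I.zeroSet)
    (x : G) (hx : x ∉ I.zeroSet)
    (X Y : Submodule ℂ (FourierAlg.NormedDual I.toSpace))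
    (hX : I.IsClosedSubmodule X) (hY : I.IsClosedSubmodule Y) (hYX : Y ≤ X)
    (hφX : I.toSpace.eval x ∈ X) (hφY : I.toSpace.eval x ∈ Y)
    (m : FourierAlg.NormedDual Y) (hm : I.IsTIM Y x hφY m) :
    ∃ M : FourierAlg.NormedDual X, I.IsTIM X x hφX M ∧
      ∀ (T : FourierAlg.NormedDual I.toSpace) (hT : T ∈ Y), M ⟨T, hYX hT⟩ = m ⟨T, hT⟩ := by
  have hP : FourierAlg.HasPointUnits 𝒜 := by
    rcases h𝒜 with rfl | rfl | rfl
    · exact FourierAlg.hasPointUnits_fourierAlgebra μ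
    · exact (FourierAlg.isFourierExtension_cbMultiplierAlgebra μ).hasPointUnits_closureOf
    · exact (FourierAlg.isFourierExtension_multiplierAlgebra μ).hasPointUnits_closureOf
  obtain ⟨M, hMn, hMact, hMm⟩ := FourierAlg.ClosedIdeal.exists_extension hP hY hφY hm
  have hφ : M (I.toSpace.eval x) = 1 := (hMm _ hφY).trans hm.apply_eval
  obtain ⟨N, hN⟩ : ∃ N : FourierAlg.NormedDual X, ∀ T : X, N T = M T :=
    ⟨M.comp X.subtypeL, fun _ => rfl⟩
  have hle : ‖N‖ ≤ 1 := by
    refine ContinuousLinearMap.opNorm_le_bound _ zero_le_one fun T => ?_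
    rw [hN]
    exact (M.le_opNorm T).trans (mul_le_mul_of_nonneg_right hMn (norm_nonneg _))
  refine ⟨N, ⟨le_antisymm hle ?_, (hN _).trans hφ, fun u T S h => ?_⟩,
    fun T hT => (hN _).trans (hMm T hT)⟩
  -- The norm is attained at φ_x, which has norm at most 1 and is mapped to 1.
  · have h1 := N.le_opNorm ⟨I.toSpace.eval x, hφX⟩
    rw [hN, hφ, norm_one] at h1
    refine h1.trans (mul_le_of_le_one_right (norm_nonneg _) ?_)
    exact FourierAlg.ClosedIdeal.norm_eval_le x
  · rw [hN, hN, (FourierAlg.ClosedIdeal.isAction_iff hP).1 h, hMact]
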